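/- **Setting.** Let $\mathbb H$ be the upper half plane and let $I$ be the geodesic from $0$ to $\infty$. The Farey complex $\mathcal F$ is the ideal triangulation of $\mathbb H$ whose edges are the images of $I$ under $SL_2(\mathbb Z)$. For $d\ge 1$, $\frac1d\mathcal F$ is its image under $z\mapsto z/d$. Let $n\ge 1$ and let $\pi:\mathbb H\to\Gamma_0(n)\backslash\mathbb H$ be the projection. For $d\mid n$ the group $\Gamma_0(n)$ preserves $\frac1d\mathcal F$. *Cutting sequences in $\mathbb H$.* An oriented geodesic that enters an ideal triangle $ABC$ (labelled clockwise) through the side $AB$ forms with it a left triangle if it leaves through $BC$ and a right triangle if it leaves through $AC$. If it leaves through the vertex $C$, the triangle may be counted as either. For a geodesic ray $\widetilde\zeta$ that starts on an edge of an ideal triangulation $T$, the cutting sequence $(\widetilde\zeta,T)$ is the finite or infinite word in $L,R$ that records in order the types of the triangles it cuts. If the ray ends at a vertex of $T$, the word is finite, and the two words that differ only in the last letter are both taken to represent $(\widetilde\zeta,T)$. A word $L^{n_0}R^{n_1}L^{n_2}\cdots$ with $n_0\ge 0$ and $n_i\ge 1$ for $i\ge 1$ is said to correspond to the continued fraction $[n_0;n_1,n_2,\dots]$.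 *Quotient triangulations.* For $d\mid n$, let $T_{\{d,n\}}/{\sim}$ be the projection of $\frac1d\mathcal F$ to $\Gamma_0(n)\backslash\mathbb H$ (arcs ending at cone points of angle $2\pi/3$ play no role and are left out). For a geodesic path $\zeta$ on $\Gamma_0(n)\backslash\mathbb H$, the cutting sequence $(\zeta,T_{\{d,n\}}/{\sim})$ records in order the types of the triangles that $\zeta$ cuts. The passage of $\zeta$ through a triangle forms a left (right) triangle if a geodesic lift of this passage to $\mathbb H$ cuts a triangle of the lift $\pi^{-1}(T_{\{d,n\}}/{\sim})$ to form a left (right) triangle. Leaving through a vertex is treated as above. **Theorem.** Let $n\ge 1$ and $\alpha>0$, let $\widetilde\zeta$ be a geodesic ray in $\mathbb H$ that starts on $I$ and ends at $\alpha$, and let $\zeta=\pi\circ\widetilde\zeta$ be its projection to $\Gamma_0(n)\backslash\mathbb H$. Then, for every $d\mid n$: 1. If $P_n$ is a special polygon (the polygon with side pairings given by a Farey symbol) that is a fundamental domain of $\Gamma_0(n)$ and has $I$ and $I+1$ as paired sides, then the decoration $P_n\cap\frac1d\mathcal F$ of $P_n$, taken in the quotient $P_n/{\sim}=\Gamma_0(n)\backslash\mathbb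 H$ by the side pairings, is $T_{\{d,n\}}/{\sim}$. 2. $(\widetilde\zeta,\tfrac1d\mathcal F)=(\zeta,T_{\{d,n\}}/{\sim})$, that is, the same words represent both cutting sequences. 3. The words that represent $(\zeta,T_{\{d,n\}}/{\sim})$ are exactly those that correspond to the continued fraction expansions of $d\alpha$. In particular, for $d=1$ and $d=n$, the cutting sequence of $\zeta$ with $T_{\{1,n\}}/{\sim}$ corresponds to the continued fraction of $\alpha$, and that with $T_{\{n,n\}}/{\sim}$ corresponds to the continued fraction of $n\alpha$. So multiplying a continued fraction by $n$ amounts to replacing one quotient triangulation of $\Gamma_0(n)\backslash\mathbb H$ by another. -/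

import Mathlib

open Filter Topology UpperHalfPlane
open scoped MatrixGroups

noncomputable section

namespace CuttingSeq

/-! ### Geodesics and geodesic rays of the upper half plane -/

/-- The point `exp t * i` of the `y`-axis; `t` is its signed hyperbolic distance from `i`. -/
def axisPoint (t : ℝ) : ℍ :=
  ⟨(Real.exp t : ℂ) * Complex.I, by
    simpa only [Complex.re_ofReal_mul, Complex.im_ofReal_mul, Complex.I_im, mul_one]
      using Real.exp_pos t⟩

/-- The oriented unit-speed geodesic obtained from the `y`-axis (run from `0` to `∞`) by the
orientation-preserving isometry `g`.  All oriented unit-speed geodesics of `ℍ` arise so. -/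
def geodesic (g : SL(2, ℝ)) (t : ℝ) : ℍ := g • axisPoint t

/-- `γ`, restricted to `[0, ∞)`, is a (unit-speed) geodesic ray. -/
def IsGeodesicRay (γ : ℝ → ℍ) : Prop :=
  ∃ g : SL(2, ℝ), ∀ t : ℝ, 0 ≤ t → γ t = geodesic g t

/-! ### The Farey complex and its scalings -/

/-- The geodesic line `I` from `0` to `∞`. -/
def axis : Set ℍ := {z | z.re = 0}

/-- The union of the edges of the Farey complex: all images of `I` under `SL(2, ℤ)`. -/
def farey : Set ℍ := {z | ∃ A : SL(2, ℤ), ∃ w ∈ axis, z = A • w}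

/-- The union of the edges of the scaled Farey complex `(1/d) 𝓕` (used for `d ≥ 1`). -/
def scaledFarey (d : ℕ) : Set ℍ := {z | ∃ w ∈ farey, (z : ℂ) = (w : ℂ) / (d : ℂ)}

/-! ### Ideal triangles, and how a geodesic cuts them

An ideal triangulation is given by its `1`-skeleton, the union `X` of its edges; its triangles are
the ideal triangles whose sides lie in `X` and whose interior misses `X`.

Every ideal triangle, with its vertices `A, B, C` listed clockwise, is `h • (0, ∞, 1)` for some
`h` in `SL(2, ℝ)`. -/

/-- The two letters: a left triangle or a right triangle. -/
inductive Letter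
  | L
  | R

/-- The interior of the ideal triangle with vertices `0, ∞, 1`. -/
def triangleInterior : Set ℍ := {z | 0 < z.re ∧ z.re < 1 ∧ z.re < Complex.normSq (z : ℂ)}

/-- For the triangle `A = 0, B = ∞, C = 1` entered through `AB`, the side through which one leaves:
`BC` (the line from `1` to `∞`) for a left triangle, and `AC` (the half circle from `0` to `1`) for
a right triangle. -/
def exitSide : Letter → Set ℍ
  | .L => {z | z.re = 1}
  | .R => {z | Complex.normSq (z : ℂ) = z.re}

/-- The ideal triangle `h • (0, ∞, 1)` is a triangle of the triangulation with `1`-skeleton `X`. -/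
def IsTriangle (X : Set ℍ) (h : SL(2, ℝ)) : Prop :=
  (∀ z ∈ axis, h • z ∈ X) ∧ (∀ l, ∀ z ∈ exitSide l, h • z ∈ X) ∧
    ∀ z ∈ triangleInterior, h • z ∉ X

/-- Between the times `s` and `t`, the path `γ` crosses a triangle of `X`, entering and leaving
through two different sides, and forms with it a triangle of type `l`. -/
def Cuts (X : Set ℍ) (γ : ℝ → ℍ) (l : Letter) (s t : ℝ) : Prop :=
  s < t ∧ ∃ h : SL(2, ℝ), IsTriangle X h ∧ h⁻¹ • γ s ∈ axis ∧
    (∀ u ∈ Set.Ioo s t, h⁻¹ • γ u ∈ triangleInterior) ∧ h⁻¹ • γ t ∈ exitSide l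

/-- At time `s` the path `γ` enters a triangle of `X` through a side, and then runs inside that
triangle into the vertex `C` opposite to that side. -/
def EndsAtVertex (X : Set ℍ) (γ : ℝ → ℍ) (s : ℝ) : Prop :=
  ∃ h : SL(2, ℝ), IsTriangle X h ∧ h⁻¹ • γ s ∈ axis ∧
    (∀ u ∈ Set.Ioi s, h⁻¹ • γ u ∈ triangleInterior) ∧
    Tendsto (fun u => ((h⁻¹ • γ u : ℍ) : ℂ)) atTop (𝓝 1)

/-! ### Cutting sequences -/

/-- The finite or infinite word `w` records, one after the other from time `0` on, the types of the
triangles that are cut.  Here `cuts l s t` says that a triangle of type `l` is cut between the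
times `s` and `t`, and `ends s` that the path, from time `s` on, runs into the opposite vertex of a
triangle; that last triangle may be counted as a left or as a right one. -/
def IsCuttingWord (cuts : Letter → ℝ → ℝ → Prop) (ends : ℝ → Prop)
    (w : Stream'.Seq Letter) : Prop :=
  ∃ t : ℕ → ℝ, t 0 = 0 ∧ w.get? 0 ≠ none ∧
    ∀ k l, w.get? k = some l →
      (cuts l (t k) (t (k + 1)) ∧ w.get? (k + 1) ≠ none) ∨
      (ends (t k) ∧ w.get? (k + 1) = none)

/-- The cutting sequence of a ray `γ` of `ℍ`, starting on an edge, with the triangulation with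
`1`-skeleton `X`: the set of the words that represent it.  (If the ray ends at a vertex then two
words, which differ in their last letter, represent the same cutting sequence.) -/
def cuttingSequence (X : Set ℍ) (γ : ℝ → ℍ) : Set (Stream'.Seq Letter) :=
  {w | IsCuttingWord (Cuts X γ) (EndsAtVertex X γ) w}

/-! ### The orbifold `Γ₀(n)\ℍ` and cutting sequences on it -/

/-- The quotient `Γ₀(n)\ℍ`. -/
abbrev Orbifold (n : ℕ) : Type :=
  MulAction.orbitRel.Quotient (CongruenceSubgroup.Gamma0 n) ℍ

/-- The projection of `ℍ` onto `Γ₀(n)\ℍ`. -/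
def proj (n : ℕ) (z : ℍ) : Orbifold n := Quotient.mk _ z

/-- The geodesic `geodesic g` lifts the part of the path `ζ` on `Γ₀(n)\ℍ` with times in `J`. -/
def IsLift (n : ℕ) (ζ : ℝ → Orbifold n) (g : SL(2, ℝ)) (J : Set ℝ) : Prop :=
  ∀ u ∈ J, proj n (geodesic g u) = ζ u

/-- Between the times `s` and `t`, the geodesic path `ζ` on `Γ₀(n)\ℍ` cuts a triangle of the
quotient triangulation with support `T` (without structural arcs) to form a triangle of type `l`:
a lift of this part of `ζ` so cuts a triangle of the lifted triangulation. -/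
def OrbCuts (n : ℕ) (T : Set (Orbifold n)) (ζ : ℝ → Orbifold n) (l : Letter) (s t : ℝ) : Prop :=
  ∃ g : SL(2, ℝ), IsLift n ζ g (Set.Icc s t) ∧ Cuts (proj n ⁻¹' T) (geodesic g) l s t

/-- From time `s` on, the geodesic path `ζ` on `Γ₀(n)\ℍ` runs into the opposite vertex (a cusp) of
a triangle of the quotient triangulation with support `T`. -/
def OrbEndsAtVertex (n : ℕ) (T : Set (Orbifold n)) (ζ : ℝ → Orbifold n) (s : ℝ) : Prop :=
  ∃ g : SL(2, ℝ), IsLift n ζ g (Set.Ici s) ∧ EndsAtVertex (proj n ⁻¹' T) (geodesic g) s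

/-- The cutting sequence of a geodesic path `ζ` on `Γ₀(n)\ℍ` with the quotient triangulation with
support `T`: the set of the words that represent it. -/
def orbCuttingSequence (n : ℕ) (T : Set (Orbifold n)) (ζ : ℝ → Orbifold n) :
    Set (Stream'.Seq Letter) :=
  {w | IsCuttingWord (OrbCuts n T ζ) (OrbEndsAtVertex n T ζ) w}

/-- The quotient triangulation of `Γ₀(n)\ℍ` induced by `(1/d) 𝓕` (without structural arcs): the
projection of `(1/d) 𝓕`, given by the union of its arcs. -/
def quotientTriangulation (n d : ℕ) : Set (Orbifold n) := proj n '' scaledFarey d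

/-! ### Farey symbols, special polygons and decorated tiles -/

/-- The three types of intervals of a Farey symbol with `k + 1` intervals; a free interval is given
with the other free interval that has the same label. -/
inductive IntervalType (k : ℕ)
  | free (partner : Fin (k + 1))
  | even
  | odd

/-- A Farey symbol `∞, x₀, …, x_r, ∞` with `k + 1 = r + 2` intervals.  The vertices are the
fractions `a i / b i` in reduced form, the first one being `-1/0` and the last one `1/0`.
The condition `adj` says that consecutive vertices are Farey neighbours, in increasing order. -/
structure FareySymbol where
  k : ℕ
  a : Fin (k + 2) → ℤ
  b : Fin (k + 2) → ℤ
  first : a 0 = -1 ∧ b 0 = 0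
  last : a (Fin.last (k + 1)) = 1 ∧ b (Fin.last (k + 1)) = 0
  pos : ∀ i, i ≠ 0 → i ≠ Fin.last (k + 1) → 0 < b i
  adj : ∀ i : Fin (k + 1), a i.succ * b i.castSucc - a i.castSucc * b i.succ = 1
  zero : ∃ i, a i = 0
  type : Fin (k + 1) → IntervalType k
  free_pair : ∀ i j, type i = .free j → j ≠ i ∧ type j = .free i

namespace FareySymbol

/-- The element of `SL(2, ℤ)` that maps `0` and `∞` to the ends of the `i`-th interval; the
half plane `Re > 0` goes to the side of the `i`-th edge that is away from the polygon. -/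
def edge (σ : FareySymbol) (i : Fin (σ.k + 1)) : SL(2, ℤ) :=
  ⟨!![σ.a i.succ, σ.a i.castSucc; σ.b i.succ, σ.b i.castSucc], by
    rw [Matrix.det_fin_two_of]; exact σ.adj i⟩

/-- The third of the triangle `0, 1, ∞` that has the side from `0` to `∞` and the centre of that
triangle as its third vertex. -/
def third : Set ℍ := {z | 0 ≤ z.re ∧ z.re ≤ 1 / 2 ∧ 1 ≤ Complex.normSq ((z : ℂ) - 1)}

/-- The special polygon of a Farey symbol: the ideal polygon with vertices `∞, x₀, …, x_r`,
enlarged, for every odd interval, by a third of the adjacent Farey triangle. -/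
def polygon (σ : FareySymbol) : Set ℍ :=
  {z | (∀ i, ((σ.edge i)⁻¹ • z).re ≤ 0) ∨ ∃ i, σ.type i = .odd ∧ (σ.edge i)⁻¹ • z ∈ third}

/-- The order-two element that exchanges `0` and `∞`. -/
def swap : SL(2, ℤ) := ⟨!![0, -1; 1, 0], by simp [Matrix.det_fin_two_of]⟩

/-- The order-three element `0 ↦ ∞ ↦ 1 ↦ 0`. -/
def rot : SL(2, ℤ) := ⟨!![1, -1; 1, 0], by simp [Matrix.det_fin_two_of]⟩

/-- The side pairing of the `i`-th interval.  A free interval `x, x'` with partner `y, y'` gives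
`x ↦ y', x' ↦ y`; an even one `x, x'` gives `x ↦ x' ↦ x`; an odd one `x, x'` gives
`x ↦ x' ↦ x ⊕ x' ↦ x`. -/
def pairing (σ : FareySymbol) (i : Fin (σ.k + 1)) : SL(2, ℤ) :=
  match σ.type i with
  | .free j => σ.edge j * swap * (σ.edge i)⁻¹
  | .even => σ.edge i * swap * (σ.edge i)⁻¹
  | .odd => σ.edge i * rot * (σ.edge i)⁻¹

/-- The special polygon of `σ` is a fundamental domain `P_n` of `Γ₀(n)`: the side pairings generate
`Γ₀(n)` (modulo `±1`), the translates of the polygon cover `ℍ`, and their interiors do not overlap.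
Moreover, `I` and `I + 1` are paired sides. -/
structure IsTile (σ : FareySymbol) (n : ℕ) : Prop where
  generates : Subgroup.closure (Set.range σ.pairing ∪ {-1}) = CongruenceSubgroup.Gamma0 n
  covers : ∀ z : ℍ, ∃ g ∈ CongruenceSubgroup.Gamma0 n, g • z ∈ σ.polygon
  disjoint : ∀ g ∈ CongruenceSubgroup.Gamma0 n, g ≠ 1 → g ≠ -1 →
    ∀ z ∈ interior σ.polygon, g • z ∉ interior σ.polygon
  left_side : σ.a (Fin.succ 0) = 0 ∧ σ.b (Fin.succ 0) = 1
  right_side : σ.a (Fin.last σ.k).castSucc = 1 ∧ σ.b (Fin.last σ.k).castSucc = 1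
  paired : σ.type 0 = .free (Fin.last σ.k)

/-- `T_{d,n}/∼`: the decoration `P_n ∩ (1/d) 𝓕` of the polygon `P_n` of `σ`, taken in the quotient
`P_n/∼ = Γ₀(n)\ℍ`. -/
def tileTriangulation (σ : FareySymbol) (n d : ℕ) : Set (Orbifold n) :=
  proj n '' (σ.polygon ∩ scaledFarey d)

end FareySymbol

/-! ### Words and continued fractions -/

/-- A finite or infinite sequence of indices `n₀, n₁, n₂, …` with `n₀ ≥ 0` and `n_i ≥ 1` for
`i ≥ 1`. -/
structure IndexSeq where
  head : ℕ
  tail : Stream'.Seq ℕ+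

namespace IndexSeq

/-- The index `n_k`, if there is one. -/
def get? (a : IndexSeq) : ℕ → Option ℕ
  | 0 => some a.head
  | k + 1 => (a.tail.get? k).map (fun m => (m : ℕ))

/-- `n₀ + ⋯ + n_{k-1}`, the number of letters before the `k`-th block. -/
def offset (a : IndexSeq) (k : ℕ) : ℕ := ∑ i ∈ Finset.range k, (a.get? i).getD 0

/-- `w` is the word `L^{n₀} R^{n₁} L^{n₂} ⋯`. -/
def IsWord (a : IndexSeq) (w : Stream'.Seq Letter) : Prop :=
  ∀ j l, w.get? j = some l ↔
    ∃ k m, a.get? k = some m ∧ a.offset k ≤ j ∧ j < a.offset k + m ∧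
      l = if Even k then Letter.L else Letter.R

/-- The continued fraction `[n₀; n₁, n₂, …]`. -/
def toContFract (a : IndexSeq) : GenContFract ℝ :=
  ⟨(a.head : ℝ), a.tail.map (fun m : ℕ+ => ⟨1, ((m : ℕ) : ℝ)⟩)⟩

/-- `[n₀; n₁, n₂, …]` is a continued fraction expansion of `x`.  (The convergents of a finite
continued fraction are eventually constant.) -/
def IsExpansionOf (a : IndexSeq) (x : ℝ) : Prop :=
  Tendsto a.toContFract.convs atTop (𝓝 x)

end IndexSeq

end CuttingSeq

end

noncomputable section

namespace CuttingSeq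

/-! ### The slow continued fraction map and its words -/

/-! The geometry and the arithmetic are driven by the same map, `fareyMap`, applied to the forward
end of the ray. Under `z ↦ d z` the triangulation becomes the Farey complex, and the ray crosses the
axis towards `x = d α`. It enters the triangle `0, ∞, 1` and leaves through the side from `1` to `∞`
if `x > 1`, through the side from `0` to `1` if `x < 1`, or runs into the vertex `1` if `x = 1`. The
element of `SL(2, ℤ)` that carries the exit side back to the axis preserves the Farey complex and
replaces `x` by `x - 1` or `x / (1 - x)`, so the picture repeats (`Enters.exists_cuts_L`,
`Enters.exists_cuts_R`, `Enters.endsAtVertex`). A triangle is determined by a point of its entry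
side and an inner point (`inv_smul_eq_inv_smul`), so times and letters are forced, and the cutting
words are exactly the itineraries of `x` (`IsItinerary.isCuttingWord_iff`).

On continued fractions the same map strips one letter: `x - 1` lowers `n₀`, and `x / (1 - x)`, whose
reciprocal is `1 / x - 1`, lowers `n₁` when `n₀ = 0` (`isExpansionOf_cases`). Hence itineraries are
the words of expansions (`isFareyWord_iff`); the free last letter at `x = 1` is the choice between
`[1]` and `[0; 1]`.

For the quotient, `z ↦ d z` conjugates `Γ₀(n)` into `SL(2, ℤ)` when `d ∣ n`, so `(1/d) 𝓕` is
invariant and is the full preimage of its projection. Two lifts of one path differ by an element of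
`Γ₀(n)`, because that group is countable while an interval of times is not
(`exists_geodesic_eq_smul`); so cuts can be read upstairs on any lift. Covering `ℍ` by translates of
the polygon gives the statement on tiles. -/

/-- The slow continued fraction map: `x ↦ x - 1` for `x > 1`, and `x ↦ x / (1 - x)` for `x < 1`. -/
def fareyMap (x : ℝ) : ℝ := if 1 < x then x - 1 else if x < 1 then x / (1 - x) else x

lemma fareyMap_of_one_lt {x : ℝ} (h : 1 < x) : fareyMap x = x - 1 := if_pos h

lemma fareyMap_of_lt_one {x : ℝ} (h : x < 1) : fareyMap x = x / (1 - x) := by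
  rw [fareyMap, if_neg h.not_gt, if_pos h]

lemma fareyMap_pos {x : ℝ} (h : 0 < x) : 0 < fareyMap x := by
  unfold fareyMap
  split_ifs with h1 h2
  · linarith
  · exact div_pos h (by linarith)
  · exact h

lemma fareyMap_iterate_pos {x : ℝ} (h : 0 < x) (k : ℕ) : 0 < fareyMap^[k] x := by
  induction k with
  | zero => exact h
  | succ k ih => rw [Function.iterate_succ_apply']; exact fareyMap_pos ih

/-- `w` records the itinerary of `x` under `fareyMap`, until it hits `1`, where the last letter is
arbitrary. -/
def IsFareyWord (x : ℝ) (w : Stream'.Seq Letter) : Prop :=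
  w.get? 0 ≠ none ∧ ∀ k l, w.get? k = some l →
    ((l = .L ∧ 1 < fareyMap^[k] x ∨ l = .R ∧ fareyMap^[k] x < 1) ∧ w.get? (k + 1) ≠ none) ∨
      (fareyMap^[k] x = 1 ∧ w.get? (k + 1) = none)

lemma get?_ne_none_of_le {β : Type*} {w : Stream'.Seq β} {i j : ℕ} (hij : i ≤ j)
    (h : w.get? j ≠ none) : w.get? i ≠ none :=
  fun hi => h (w.le_stable hij hi)

/-! ### Blocks and letters of the word of an index sequence. -/

namespace IndexSeq

/-- The `j`-th letter of the word of `a` is `l`. -/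
def LetterAt (a : IndexSeq) (j : ℕ) (l : Letter) : Prop :=
  ∃ k m, a.get? k = some m ∧ a.offset k ≤ j ∧ j < a.offset k + m ∧
    l = if Even k then Letter.L else Letter.R

lemma offset_zero (a : IndexSeq) : a.offset 0 = 0 := rfl

lemma offset_succ (a : IndexSeq) (k : ℕ) :
    a.offset (k + 1) = a.offset k + (a.get? k).getD 0 := Finset.sum_range_succ _ _

lemma get?_zero (m : ℕ) (s : Stream'.Seq ℕ+) : get? ⟨m, s⟩ 0 = some m := rfl

lemma get?_nil_succ (m k : ℕ) : get? ⟨m, .nil⟩ (k + 1) = none := rfl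

lemma get?_cons_succ (m : ℕ) (n : ℕ+) (s : Stream'.Seq ℕ+) (k : ℕ) :
    get? ⟨m, .cons n s⟩ (k + 1) = get? ⟨n, s⟩ k := by
  cases k <;> simp [get?]

lemma offset_one (m : ℕ) (s : Stream'.Seq ℕ+) : offset ⟨m, s⟩ 1 = m := by
  rw [offset_succ, offset_zero, get?_zero]; simp

lemma offset_cons_succ (m : ℕ) (n : ℕ+) (s : Stream'.Seq ℕ+) (k : ℕ) :
    offset ⟨m, .cons n s⟩ (k + 1) = m + offset ⟨n, s⟩ k := by
  induction k with
  | zero => simp [offset_one, offset_zero]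
  | succ k ih => rw [offset_succ, ih, offset_succ ⟨n, s⟩, get?_cons_succ]; ring

lemma letterAt_nil {m j : ℕ} {l : Letter} : LetterAt ⟨m, .nil⟩ j l ↔ j < m ∧ l = .L := by
  constructor
  · rintro ⟨k, m', h1, h2, h3, rfl⟩
    cases k with
    | zero => obtain rfl : m = m' := by simpa [get?_zero] using h1
              simpa [offset_zero] using h3
    | succ k => simp [get?_nil_succ] at h1
  · rintro ⟨h, rfl⟩
    exact ⟨0, m, rfl, by simp [offset_zero], by simpa [offset_zero] using h, by simp⟩

/-- Exchange the letters `L` and `R`. -/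
def flip : Letter → Letter
  | .L => .R
  | .R => .L

/-- Deleting the leading block lowers every block index by one. This reverses parities, hence the
`flip`. -/
lemma letterAt_cons {m : ℕ} {n : ℕ+} {s : Stream'.Seq ℕ+} {j : ℕ} {l : Letter} :
    LetterAt ⟨m, .cons n s⟩ j l ↔
      (j < m ∧ l = .L) ∨ (m ≤ j ∧ LetterAt ⟨n, s⟩ (j - m) (flip l)) := by
  constructor
  · rintro ⟨k, m', h1, h2, h3, rfl⟩
    cases k with
    | zero => obtain rfl : m = m' := by simpa [get?_zero] using h1
              left; simpa [offset_zero] using h3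
    | succ k =>
      rw [get?_cons_succ] at h1
      rw [offset_cons_succ] at h2 h3
      refine Or.inr ⟨by omega, k, m', h1, by omega, by omega, ?_⟩
      by_cases hk : Even k <;> simp [hk, Nat.even_add_one, flip]
  · rintro (⟨h, rfl⟩ | ⟨hj, k, m', h1, h2, h3, h4⟩)
    · exact ⟨0, m, rfl, by simp [offset_zero], by simpa [offset_zero] using h, by simp⟩
    · refine ⟨k + 1, m', by rwa [get?_cons_succ], by rw [offset_cons_succ]; omega,
        by rw [offset_cons_succ]; omega, ?_⟩
      by_cases hk : Even k <;> cases l <;> simp_all [Nat.even_add_one, flip]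

lemma letterAt_head_succ_zero {m : ℕ} {s : Stream'.Seq ℕ+} {l : Letter} :
    LetterAt ⟨m + 1, s⟩ 0 l ↔ l = .L := by
  cases s using Stream'.Seq.recOn with
  | nil => simp [letterAt_nil]
  | cons n s => simp [letterAt_cons]

lemma letterAt_head_succ_succ {m : ℕ} {s : Stream'.Seq ℕ+} {j : ℕ} {l : Letter} :
    LetterAt ⟨m + 1, s⟩ (j + 1) l ↔ LetterAt ⟨m, s⟩ j l := by
  cases s using Stream'.Seq.recOn with
  | nil => simp [letterAt_nil]
  | cons n s => simp [letterAt_cons]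

lemma flip_flip (l : Letter) : flip (flip l) = l := by cases l <;> rfl

lemma flip_eq_L {l : Letter} : flip l = .L ↔ l = .R := by cases l <;> simp [flip]

lemma letterAt_zero_cons {n : ℕ+} {s : Stream'.Seq ℕ+} {j : ℕ} {l : Letter} :
    LetterAt ⟨0, .cons n s⟩ j l ↔ LetterAt ⟨n, s⟩ j (flip l) := by
  simp [letterAt_cons]

lemma toContFract_convs_eq (a : IndexSeq) : a.toContFract.convs = a.toContFract.convs' := by
  ext k
  -- The recurrence and the nested fraction agree because all partial denominators are positive; the
  -- nested form can be unfolded from the head.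
  refine GenContFract.convs_eq_convs' fun {gp m} _ h => ?_
  simp only [toContFract, Stream'.Seq.map_get?, Option.map_eq_some_iff] at h
  obtain ⟨n, -, rfl⟩ := h
  exact ⟨one_pos, Nat.cast_pos.mpr n.pos⟩

lemma convs_zero (m : ℕ) (s : Stream'.Seq ℕ+) : (toContFract ⟨m, s⟩).convs 0 = m := by
  rw [toContFract_convs_eq]; simp [GenContFract.convs', toContFract, GenContFract.convs'Aux]

lemma convs_nil (m k : ℕ) : (toContFract ⟨m, .nil⟩).convs k = m := by
  rw [toContFract_convs_eq]
  cases k <;> simp [GenContFract.convs', toContFract, GenContFract.convs'Aux]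

lemma convs_cons_succ (m : ℕ) (n : ℕ+) (s : Stream'.Seq ℕ+) (k : ℕ) :
    (toContFract ⟨m, .cons n s⟩).convs (k + 1) = m + 1 / (toContFract ⟨n, s⟩).convs k := by
  rw [toContFract_convs_eq, toContFract_convs_eq]
  simp [GenContFract.convs', toContFract, GenContFract.convs'Aux]

lemma convs_head_succ (m : ℕ) (s : Stream'.Seq ℕ+) (k : ℕ) :
    (toContFract ⟨m + 1, s⟩).convs k = (toContFract ⟨m, s⟩).convs k + 1 := by
  rw [toContFract_convs_eq, toContFract_convs_eq]
  simp only [GenContFract.convs', toContFract, Nat.cast_add, Nat.cast_one]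
  ring

lemma convs_mem_Icc (m : ℕ) (s : Stream'.Seq ℕ+) (k : ℕ) :
    (toContFract ⟨m, s⟩).convs k ∈ Set.Icc (m : ℝ) (m + 1) := by
  induction k generalizing m s with
  | zero => rw [convs_zero]; simp
  | succ k ih =>
    cases s using Stream'.Seq.recOn with
    | nil => rw [convs_nil]; simp
    | cons n s =>
      rw [convs_cons_succ]
      have h1 : (1 : ℝ) ≤ n := Nat.one_le_cast.mpr n.2
      have h2 : 1 ≤ (toContFract ⟨n, s⟩).convs k := h1.trans (ih n s).1
      constructor
      · have : 0 ≤ 1 / (toContFract ⟨n, s⟩).convs k := by positivity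
        linarith
      · have : 1 / (toContFract ⟨n, s⟩).convs k ≤ 1 := by
          rw [div_le_one (by linarith)]; exact h2
        linarith

namespace IsExpansionOf

variable {m : ℕ} {n : ℕ+} {s : Stream'.Seq ℕ+} {x : ℝ}

lemma nil_iff : IsExpansionOf ⟨m, .nil⟩ x ↔ x = m := by
  have h : (toContFract ⟨m, .nil⟩).convs = fun _ => (m : ℝ) := funext (convs_nil m)
  rw [IsExpansionOf, h, tendsto_const_nhds_iff]
  exact eq_comm

lemma head_succ_iff : IsExpansionOf ⟨m + 1, s⟩ x ↔ IsExpansionOf ⟨m, s⟩ (x - 1) := by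
  have h : (toContFract ⟨m + 1, s⟩).convs = fun k => (toContFract ⟨m, s⟩).convs k + 1 :=
    funext (convs_head_succ m s)
  rw [IsExpansionOf, IsExpansionOf, h]
  constructor <;> intro h
  · simpa using h.sub_const 1
  · simpa using h.add_const 1

lemma head_le (h : IsExpansionOf ⟨m, s⟩ x) : (m : ℝ) ≤ x :=
  ge_of_tendsto' h fun k => (convs_mem_Icc m s k).1

/-- The convergents of the tail stay at most `n + 1`, so those of the whole exceed `m` by at least
`1 / (n + 1)`. This uniform gap keeps the inequality strict in the limit. -/
lemma head_lt (h : IsExpansionOf ⟨m, .cons n s⟩ x) : (m : ℝ) < x := by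
  have h1 : (m : ℝ) + 1 / (n + 1) ≤ x := by
    refine ge_of_tendsto ((tendsto_add_atTop_iff_nat 1).mpr h) (.of_forall fun k => ?_)
    rw [convs_cons_succ]
    have h2 := convs_mem_Icc n s k
    have h1 : (1 : ℝ) ≤ n := Nat.one_le_cast.mpr n.2
    have := one_div_le_one_div_of_le (by linarith [h2.1]) h2.2
    linarith
  have : 0 < 1 / ((n : ℝ) + 1) := by positivity
  linarith

lemma one_div (h : IsExpansionOf ⟨0, .cons n s⟩ x) : IsExpansionOf ⟨n, s⟩ (1 / x) := by
  have hx : x ≠ 0 := by have := h.head_lt; simp at this; exact this.ne'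
  have h1 := ((tendsto_add_atTop_iff_nat 1).mpr h).inv₀ hx
  rw [IsExpansionOf, _root_.one_div]
  refine h1.congr fun k => ?_
  rw [convs_cons_succ]; simp

lemma zero_cons_one_div (h : IsExpansionOf ⟨n, s⟩ x) : IsExpansionOf ⟨0, .cons n s⟩ (1 / x) := by
  have hx : x ≠ 0 := by
    have := h.head_le
    have h1 : (1 : ℝ) ≤ n := Nat.one_le_cast.mpr n.2
    linarith
  have h1 := Tendsto.inv₀ h hx
  rw [IsExpansionOf, _root_.one_div]
  refine (tendsto_add_atTop_iff_nat 1).mp (h1.congr fun k => ?_)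
  rw [convs_cons_succ]; simp

end IsExpansionOf

/-! ### Removing and adding a first letter. -/

/-- The word of `a` is obtained from the word of `a'` by putting the letter `l` in front. -/
def IsPrepend (l : Letter) (a' a : IndexSeq) : Prop :=
  (∀ l', a.LetterAt 0 l' ↔ l' = l) ∧ ∀ j l', a.LetterAt (j + 1) l' ↔ a'.LetterAt j l'

lemma isPrepend_L (m : ℕ) (s : Stream'.Seq ℕ+) : IsPrepend .L ⟨m, s⟩ ⟨m + 1, s⟩ :=
  ⟨fun _ => letterAt_head_succ_zero, fun _ _ => letterAt_head_succ_succ⟩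

lemma isPrepend_R_zero (n : ℕ+) (s : Stream'.Seq ℕ+) :
    IsPrepend .R ⟨0, .cons n s⟩ ⟨0, .cons (n + 1) s⟩ := by
  refine ⟨fun l => ?_, fun j l => ?_⟩
  · rw [letterAt_zero_cons, PNat.add_coe, PNat.one_coe, letterAt_head_succ_zero, flip_eq_L]
  · rw [letterAt_zero_cons, letterAt_zero_cons, PNat.add_coe, PNat.one_coe,
      letterAt_head_succ_succ]

lemma isPrepend_R_pos (n : ℕ+) (s : Stream'.Seq ℕ+) :
    IsPrepend .R ⟨n, s⟩ ⟨0, .cons 1 (.cons n s)⟩ := by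
  refine ⟨fun l => ?_, fun j l => ?_⟩
  · rw [letterAt_zero_cons, PNat.one_coe, letterAt_head_succ_zero, flip_eq_L]
  · rw [letterAt_zero_cons, PNat.one_coe, letterAt_head_succ_succ, letterAt_zero_cons, flip_flip]

lemma head_cases (a : IndexSeq) : (∃ s, a = ⟨0, s⟩) ∨ ∃ (n : ℕ+) (s : _), a = ⟨n, s⟩ := by
  obtain ⟨m, s⟩ := a
  cases m with
  | zero => exact .inl ⟨s, rfl⟩
  | succ m => exact .inr ⟨⟨m + 1, m.succ_pos⟩, s, rfl⟩

lemma exists_prepend_L {a : IndexSeq} {x : ℝ} (h : a.IsExpansionOf x) :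
    ∃ a', IsPrepend .L a a' ∧ a'.IsExpansionOf (x + 1) := by
  obtain ⟨m, s⟩ := a
  exact ⟨_, isPrepend_L m s, by rw [IsExpansionOf.head_succ_iff]; simpa using h⟩

lemma IsExpansionOf.head_succ (n : ℕ+) {s : Stream'.Seq ℕ+} {x : ℝ}
    (h : IsExpansionOf ⟨n, s⟩ x) : IsExpansionOf ⟨(n + 1 : ℕ+), s⟩ (x + 1) := by
  rw [PNat.add_coe, PNat.one_coe, IsExpansionOf.head_succ_iff]; simpa using h

/-- The identity `x / (1 + x) = 1 / (1 / x + 1)` turns a new `R` into an increase of the index `n₁`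
by one; if the word starts with `L`, a new block `R¹` is opened instead. -/
lemma exists_prepend_R {a : IndexSeq} {x : ℝ} (hx : 0 < x) (h : a.IsExpansionOf x) :
    ∃ a', IsPrepend .R a a' ∧ a'.IsExpansionOf (x / (1 + x)) := by
  obtain ⟨s, rfl⟩ | ⟨n, s, rfl⟩ := a.head_cases
  · cases s using Stream'.Seq.recOn with
    | nil => rw [IsExpansionOf.nil_iff] at h; simp [h] at hx
    | cons n s =>
      refine ⟨_, isPrepend_R_zero n s, ?_⟩
      have := (h.one_div.head_succ n).zero_cons_one_div
      convert this using 1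
      field_simp
  · refine ⟨_, isPrepend_R_pos n s, ?_⟩
    have h1 : IsExpansionOf ⟨(1 : ℕ+), .cons n s⟩ (1 / x + 1) := by
      rw [PNat.one_coe, ← zero_add 1, IsExpansionOf.head_succ_iff]
      simpa using h.zero_cons_one_div
    convert h1.zero_cons_one_div using 1
    field_simp

/-- The head index decides the side of `1`: a positive head gives `x ≥ 1`, with equality only for
`[1]`, and a zero head gives `x ≤ 1`, with equality only for `[0; 1]`. Otherwise lowering the first
nonzero index by one realises `fareyMap`. -/
lemma isExpansionOf_cases {a : IndexSeq} {x : ℝ} (hx : 0 < x) (h : a.IsExpansionOf x) :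
    (x = 1 ∧ ∃ l, ∀ j l', a.LetterAt j l' ↔ j = 0 ∧ l' = l) ∨
    (1 < x ∧ ∃ a', IsPrepend .L a' a ∧ a'.IsExpansionOf (fareyMap x)) ∨
    (x < 1 ∧ ∃ a', IsPrepend .R a' a ∧ a'.IsExpansionOf (fareyMap x)) := by
  obtain ⟨m, s⟩ := a
  cases m with
  | succ m =>
    by_cases hx1 : 1 < x
    · refine .inr (.inl ⟨hx1, _, isPrepend_L m s, ?_⟩)
      rw [fareyMap_of_one_lt hx1, ← IsExpansionOf.head_succ_iff]
      exact h
    · left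
      have h1 := h.head_le
      push_cast at h1
      have hm : m = 0 := by
        by_contra hm
        have : (1 : ℝ) ≤ m := by exact_mod_cast Nat.one_le_iff_ne_zero.mpr hm
        linarith
      subst hm
      cases s using Stream'.Seq.recOn with
      | nil =>
        refine ⟨by simpa [IsExpansionOf.nil_iff] using h, .L, fun j l => ?_⟩
        rw [letterAt_nil]; simp
      | cons n s =>
        have := h.head_lt
        push_cast at this
        linarith
  | zero =>
    cases s using Stream'.Seq.recOn with
    | nil => rw [IsExpansionOf.nil_iff] at h; simp [h] at hx
    | cons n s =>
      have h1 := h.one_div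
      obtain rfl | ⟨n, rfl⟩ : n = 1 ∨ ∃ n', n = n' + 1 := by
        by_cases hn : n = 1
        · exact .inl hn
        · obtain ⟨k, hk⟩ := PNat.exists_eq_succ_of_ne_one hn
          exact .inr ⟨k, hk⟩
      · cases s using Stream'.Seq.recOn with
        | nil =>
          left
          rw [IsExpansionOf.nil_iff] at h1
          refine ⟨by simpa using h1, .R, fun j l => ?_⟩
          rw [letterAt_zero_cons, letterAt_nil, flip_eq_L]; simp
        | cons n s =>
          have h2 := h1.head_lt
          rw [PNat.one_coe, Nat.cast_one, lt_div_iff₀ hx, one_mul] at h2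
          refine .inr (.inr ⟨h2, _, isPrepend_R_pos n s, ?_⟩)
          rw [PNat.one_coe, ← zero_add 1, IsExpansionOf.head_succ_iff] at h1
          convert h1.one_div using 1
          rw [fareyMap_of_lt_one h2]
          field_simp
      · have h2 := h1.head_le
        have hn : (1 : ℝ) ≤ n := Nat.one_le_cast.mpr n.2
        rw [PNat.add_coe, PNat.one_coe, le_div_iff₀ hx] at h2
        push_cast at h2
        have hx1 : x < 1 := by nlinarith
        refine .inr (.inr ⟨hx1, _, isPrepend_R_zero n s, ?_⟩)
        rw [PNat.add_coe, PNat.one_coe, IsExpansionOf.head_succ_iff] at h1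
        convert h1.zero_cons_one_div using 1
        rw [fareyMap_of_lt_one hx1]
        field_simp

lemma exists_isExpansionOf {x : ℝ} (hx : 0 < x) : ∃ a : IndexSeq, a.IsExpansionOf x := by
  -- The conversions lose nothing: `x` is positive and each partial denominator is an integer at
  -- least `1`, so no default value is used.
  let a : IndexSeq := ⟨⌊x⌋.toNat, (GenContFract.of x).s.map fun p => ⌊p.b⌋.toNat.toPNat'⟩
  have ha : a.toContFract = GenContFract.of x := by
    have h0 : (⌊x⌋.toNat : ℝ) = ⌊x⌋ := by
      exact_mod_cast Int.toNat_of_nonneg (Int.floor_nonneg.mpr hx.le)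
    ext : 1
    · simpa [toContFract, a] using h0
    · refine Stream'.Seq.ext fun k => ?_
      simp only [toContFract, a, Stream'.Seq.map_get?, Option.map_map]
      cases hk : (GenContFract.of x).s.get? k with
      | none => rfl
      | some p =>
        obtain ⟨h1, z, hz⟩ := GenContFract.of_partNum_eq_one_and_exists_int_partDen_eq hk
        have h2 := GenContFract.of_one_le_get?_partDen (GenContFract.partDen_eq_s_b hk)
        obtain ⟨pa, pb⟩ := p
        simp only at h1 hz h2
        subst h1 hz
        have hz1 : 1 ≤ z := by exact_mod_cast h2
        obtain ⟨m, rfl⟩ := Int.eq_ofNat_of_zero_le (by omega : 0 ≤ z)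
        have hm : 0 < m := by omega
        simp [Nat.toPNat'_coe, hm]
  refine ⟨a, ?_⟩
  rw [IsExpansionOf, ha]
  exact GenContFract.of_convergence x

end IndexSeq

/-! ### Itineraries are the words of continued fraction expansions. -/

open IndexSeq

lemma IndexSeq.IsExpansionOf.isFareyWord {a : IndexSeq} {x : ℝ} {w : Stream'.Seq Letter}
    (hx : 0 < x) (ha : a.IsExpansionOf x) (hw : a.IsWord w) : IsFareyWord x w := by
  -- Invariant: what remains of `w` after `k` letters is the word of an expansion of the `k`-th
  -- iterate.
  have key : ∀ k, w.get? k ≠ none → ∃ a' : IndexSeq, a'.IsExpansionOf (fareyMap^[k] x) ∧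
      ∀ j l, w.get? (k + j) = some l ↔ a'.LetterAt j l := by
    intro k
    induction k with
    | zero => exact fun _ => ⟨a, ha, fun j l => by rw [zero_add]; exact hw j l⟩
    | succ k ih =>
      intro hk
      obtain ⟨a', h1, h2⟩ := ih (get?_ne_none_of_le k.le_succ hk)
      obtain ⟨l, hl⟩ := Option.ne_none_iff_exists'.mp hk
      rw [Function.iterate_succ_apply']
      have h3 (a'' : IndexSeq) (l) (h : IsPrepend l a'' a') (j : ℕ) (l' : Letter) :
          w.get? (k + 1 + j) = some l' ↔ a''.LetterAt j l' := by
        rw [← h.2, ← h2, show k + 1 + j = k + (j + 1) by ring]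
      obtain ⟨-, l', h⟩ | ⟨-, a'', h, h'⟩ | ⟨-, a'', h, h'⟩ :=
        isExpansionOf_cases (fareyMap_iterate_pos hx k) h1
      · simpa using (h _ _).mp ((h2 1 l).mp hl)
      · exact ⟨a'', h', h3 a'' _ h⟩
      · exact ⟨a'', h', h3 a'' _ h⟩
  -- The word cannot stop before the orbit reaches `1`, since an expansion of a positive number
  -- always has a first letter.
  have next {k : ℕ} {l : Letter} {a' a'' : IndexSeq}
      (h2 : ∀ j l, w.get? (k + j) = some l ↔ a'.LetterAt j l)
      (hp : IsPrepend l a'' a') (hk : a''.IsExpansionOf (fareyMap (fareyMap^[k] x))) :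
      w.get? (k + 1) ≠ none := by
    rw [← Function.iterate_succ_apply' fareyMap] at hk
    have h3 : ∃ l', a''.LetterAt 0 l' := by
      obtain ⟨-, l', h⟩ | ⟨-, a'', h, -⟩ | ⟨-, a'', h, -⟩ :=
        isExpansionOf_cases (fareyMap_iterate_pos hx _) hk
      · exact ⟨l', (h _ _).mpr ⟨rfl, rfl⟩⟩
      · exact ⟨_, (h.1 _).mpr rfl⟩
      · exact ⟨_, (h.1 _).mpr rfl⟩
    obtain ⟨l', h3⟩ := h3
    rw [← hp.2, ← h2] at h3
    simp [h3]
  constructor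
  · have h3 : ∃ l', a.LetterAt 0 l' := by
      obtain ⟨-, l', h⟩ | ⟨-, a'', h, -⟩ | ⟨-, a'', h, -⟩ := isExpansionOf_cases hx ha
      · exact ⟨l', (h _ _).mpr ⟨rfl, rfl⟩⟩
      · exact ⟨_, (h.1 _).mpr rfl⟩
      · exact ⟨_, (h.1 _).mpr rfl⟩
    obtain ⟨l', h3⟩ := h3
    rw [(hw 0 l').mpr h3]; simp
  · intro k l hl
    obtain ⟨a', h1, h2⟩ := key k (by simp [hl])
    have hl0 := (h2 0 l).mp hl
    obtain ⟨h1, l', h⟩ | ⟨h1, a'', h, h'⟩ | ⟨h1, a'', h, h'⟩ :=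
      isExpansionOf_cases (fareyMap_iterate_pos hx k) h1
    · refine .inr ⟨h1, Option.eq_none_iff_forall_ne_some.mpr fun l'' hl'' => ?_⟩
      simpa using (h _ _).mp ((h2 1 l'').mp hl'')
    · exact .inl ⟨.inl ⟨(h.1 _).mp hl0, h1⟩, next h2 h h'⟩
    · exact .inl ⟨.inr ⟨(h.1 _).mp hl0, h1⟩, next h2 h h'⟩

lemma IsFareyWord.tail {x : ℝ} {w : Stream'.Seq Letter} (h : IsFareyWord x w)
    (h1 : w.get? 1 ≠ none) : IsFareyWord (fareyMap x) w.tail := by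
  refine ⟨by rwa [Stream'.Seq.get?_tail], fun k l hl => ?_⟩
  rw [Stream'.Seq.get?_tail] at hl ⊢
  exact h.2 (k + 1) l hl

/-- An infinite itinerary never meets `1`, so each letter is forced by the position of the iterate;
any expansion of `x` then yields the same letters. -/
lemma IsFareyWord.isWord_of_forall {a : IndexSeq} {x : ℝ} {w : Stream'.Seq Letter}
    (hx : 0 < x) (ha : a.IsExpansionOf x) (hw : IsFareyWord x w) (hinf : ∀ k, w.get? k ≠ none) :
    a.IsWord w := by
  intro j
  induction j generalizing a x w with
  | zero =>
    intro l
    obtain ⟨l', hl'⟩ := Option.ne_none_iff_exists'.mp (hinf 0)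
    have h := hw.2 0 l' hl'
    simp only [hinf, and_false, or_false, ne_eq, not_false_eq_true, and_true,
      Function.iterate_zero, id] at h
    change _ ↔ a.LetterAt 0 l
    obtain ⟨h1, -⟩ | ⟨h1, a'', hp, -⟩ | ⟨h1, a'', hp, -⟩ := isExpansionOf_cases hx ha
    · rw [h1] at h; simp at h
    · have : l' = .L := by rcases h with h | h <;> [exact h.1; linarith [h.2]]
      rw [hp.1, hl', this, Option.some_inj, eq_comm]
    · have : l' = .R := by rcases h with h | h <;> [linarith [h.2]; exact h.1]
      rw [hp.1, hl', this, Option.some_inj, eq_comm]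
  | succ j ih =>
    intro l
    obtain ⟨l', hl'⟩ := Option.ne_none_iff_exists'.mp (hinf 0)
    have h := hw.2 0 l' hl'
    simp only [hinf, and_false, or_false, ne_eq, not_false_eq_true, and_true,
      Function.iterate_zero, id] at h
    change _ ↔ a.LetterAt (j + 1) l
    have ht {a'' : IndexSeq} (h' : a''.IsExpansionOf (fareyMap x)) :
        w.get? (j + 1) = some l ↔ a''.LetterAt j l := by
      rw [← Stream'.Seq.get?_tail]
      exact ih (fareyMap_pos hx) h' (hw.tail (hinf 1))
        (fun k => by rw [Stream'.Seq.get?_tail]; exact hinf _) l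
    obtain ⟨h1, -⟩ | ⟨h1, a'', hp, h'⟩ | ⟨h1, a'', hp, h'⟩ := isExpansionOf_cases hx ha
    · rw [h1] at h; simp at h
    · rw [hp.2, ht h']
    · rw [hp.2, ht h']

/-- A finite itinerary stops at `1`, where the last letter is realised by `[1]` or `[0; 1]`; the
other letters are prepended backwards, inverting `fareyMap`. -/
lemma IsFareyWord.exists_of_length {N : ℕ} {x : ℝ} {w : Stream'.Seq Letter}
    (hx : 0 < x) (hw : IsFareyWord x w) (hN : w.get? N = none) :
    ∃ a : IndexSeq, a.IsWord w ∧ a.IsExpansionOf x := by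
  induction N generalizing x w with
  | zero => exact absurd hN hw.1
  | succ N ih =>
    obtain ⟨l, hl⟩ := Option.ne_none_iff_exists'.mp hw.1
    rcases hw.2 0 l hl with ⟨h, h1⟩ | ⟨h, h1⟩
    · obtain ⟨a', h2, h3⟩ := ih (fareyMap_pos hx) (hw.tail h1)
        (by rwa [Stream'.Seq.get?_tail])
      have h4 : ∃ a, IsPrepend l a' a ∧ a.IsExpansionOf x := by
        simp only [Function.iterate_zero, id] at h
        rcases h with ⟨rfl, h⟩ | ⟨rfl, h⟩
        · obtain ⟨a, h5, h6⟩ := exists_prepend_L h3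
          refine ⟨a, h5, ?_⟩
          simpa [fareyMap_of_one_lt h] using h6
        · obtain ⟨a, h5, h6⟩ := exists_prepend_R (fareyMap_pos hx) h3
          refine ⟨a, h5, ?_⟩
          convert h6 using 1
          rw [fareyMap_of_lt_one h]
          have : 1 - x ≠ 0 := by linarith
          field_simp
          ring
      obtain ⟨a, h5, h6⟩ := h4
      refine ⟨a, fun j l' => ?_, h6⟩
      cases j with
      | zero => exact (by rw [hl, Option.some_inj, eq_comm] : _ ↔ l' = l).trans (h5.1 l').symm
      | succ j =>
        rw [← Stream'.Seq.get?_tail]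
        exact (h2 j l').trans (h5.2 j l').symm
    · simp only [Function.iterate_zero, id] at h
      subst h
      have h2 (j : ℕ) (l' : Letter) : w.get? j = some l' ↔ j = 0 ∧ l' = l := by
        cases j with
        | zero => simp [hl, eq_comm]
        | succ j => simp [w.le_stable (Nat.le_add_left 1 j) h1]
      cases l with
      | L =>
        refine ⟨⟨1, .nil⟩, fun j l' => (h2 j l').trans (Iff.symm ?_), ?_⟩
        · exact letterAt_nil.trans (by simp)
        · rw [IsExpansionOf.nil_iff]; simp
      | R =>
        refine ⟨⟨0, .cons 1 .nil⟩, fun j l' => (h2 j l').trans (Iff.symm ?_), ?_⟩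
        · exact letterAt_zero_cons.trans (letterAt_nil.trans (by simp [flip_eq_L]))
        · have : IsExpansionOf ⟨(1 : ℕ+), .nil⟩ 1 := by rw [IsExpansionOf.nil_iff]; simp
          simpa using this.zero_cons_one_div

theorem isFareyWord_iff {x : ℝ} (hx : 0 < x) (w : Stream'.Seq Letter) :
    IsFareyWord x w ↔ ∃ a : IndexSeq, a.IsWord w ∧ a.IsExpansionOf x := by
  constructor
  · intro hw
    by_cases hinf : ∀ k, w.get? k ≠ none
    · obtain ⟨a, ha⟩ := exists_isExpansionOf hx
      exact ⟨a, hw.isWord_of_forall hx ha hinf, ha⟩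
    · push Not at hinf
      obtain ⟨N, hN⟩ := hinf
      exact hw.exists_of_length hx hN
  · rintro ⟨a, h1, h2⟩
    exact h2.isFareyWord hx h1

/-! ### Coordinates of the action of `SL(2, ℝ)` -/

/-- The squared absolute value of the denominator of `g • z`. -/
def denomSq (g : SL(2, ℝ)) (z : ℍ) : ℝ := (g 1 0 * z.re + g 1 1) ^ 2 + (g 1 0 * z.im) ^ 2

lemma det_eq (g : SL(2, ℝ)) : g 0 0 * g 1 1 - g 0 1 * g 1 0 = 1 := by
  rw [← Matrix.det_fin_two, g.det_coe]

lemma denomSq_pos (g : SL(2, ℝ)) (z : ℍ) : 0 < denomSq g z := by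
  have h := det_eq g
  have hz := z.im_pos
  unfold denomSq
  by_cases hc : g 1 0 = 0
  · have : g 1 1 ≠ 0 := fun hd => by simp [hc, hd] at h
    simp only [hc, zero_mul, zero_add]
    positivity
  · positivity

lemma coe_smul_mul (g : SL(2, ℝ)) (z : ℍ) :
    ((g • z : ℍ) : ℂ) * (g 1 0 * z + g 1 1) = g 0 0 * z + g 0 1 := by
  have h : (g 1 0 * z + g 1 1 : ℂ) ≠ 0 := by
    intro h
    have h1 := congrArg Complex.re h
    have h2 := congrArg Complex.im h
    have h3 := denomSq_pos g z
    simp at h1 h2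
    simp only [denomSq, h1] at h3
    rcases h2 with h2 | h2 <;> simp [h2] at h3
  rw [coe_specialLinearGroup_apply]
  exact div_mul_cancel₀ _ h

/-- Real and imaginary parts of `(g • z) (c z + d) = a z + b`; clearing the denominator makes the
later formulas linear combinations of these two and the determinant. -/
lemma smul_re_im_aux (g : SL(2, ℝ)) (z : ℍ) :
    (g • z).re * (g 1 0 * z.re + g 1 1) - (g • z).im * (g 1 0 * z.im) = g 0 0 * z.re + g 0 1 ∧
    (g • z).re * (g 1 0 * z.im) + (g • z).im * (g 1 0 * z.re + g 1 1) = g 0 0 * z.im := by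
  have h := coe_smul_mul g z
  have h1 := congrArg Complex.re h
  have h2 := congrArg Complex.im h
  simpa using And.intro h1 h2

lemma smul_re_mul (g : SL(2, ℝ)) (z : ℍ) :
    (g • z).re * denomSq g z = g 0 0 * g 1 0 * (z.re ^ 2 + z.im ^ 2) +
      (g 0 0 * g 1 1 + g 0 1 * g 1 0) * z.re + g 0 1 * g 1 1 := by
  obtain ⟨h1, h2⟩ := smul_re_im_aux g z
  unfold denomSq
  linear_combination (g 1 0 * z.re + g 1 1) * h1 + (g 1 0 * z.im) * h2

lemma smul_im_mul (g : SL(2, ℝ)) (z : ℍ) : (g • z).im * denomSq g z = z.im := by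
  obtain ⟨h1, h2⟩ := smul_re_im_aux g z
  unfold denomSq
  linear_combination (g 1 0 * z.re + g 1 1) * h2 - (g 1 0 * z.im) * h1 + z.im * det_eq g

lemma smul_sq_mul (g : SL(2, ℝ)) (z : ℍ) :
    ((g • z).re ^ 2 + (g • z).im ^ 2) * denomSq g z =
      (g 0 0 * z.re + g 0 1) ^ 2 + (g 0 0 * z.im) ^ 2 := by
  obtain ⟨h1, h2⟩ := smul_re_im_aux g z
  rw [← h1, ← h2]
  unfold denomSq
  ring

lemma coe_int_smul (A : SL(2, ℤ)) (z : ℍ) : ((A : SL(2, ℝ)) • z : ℍ) = A • z := by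
  ext
  rw [coe_specialLinearGroup_apply, coe_specialLinearGroup_apply]
  rfl

lemma mem_axis {z : ℍ} : z ∈ axis ↔ z.re = 0 := Iff.rfl

lemma mem_triangleInterior {z : ℍ} :
    z ∈ triangleInterior ↔ 0 < z.re ∧ z.re < 1 ∧ z.re < z.re ^ 2 + z.im ^ 2 := by
  rw [pow_two, pow_two]; rfl

lemma mem_exitSide_L {z : ℍ} : z ∈ exitSide .L ↔ z.re = 1 := Iff.rfl

lemma mem_exitSide_R {z : ℍ} : z ∈ exitSide .R ↔ z.re ^ 2 + z.im ^ 2 = z.re := by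
  rw [pow_two, pow_two]; rfl

lemma not_mem_exitSide {z : ℍ} (hz : z ∈ triangleInterior) (l : Letter) : z ∉ exitSide l := by
  rw [mem_triangleInterior] at hz
  cases l
  · rw [mem_exitSide_L]; exact hz.2.1.ne
  · rw [mem_exitSide_R]; exact hz.2.2.ne'

lemma exitSide_injective {z : ℍ} {l l' : Letter} (h : z ∈ exitSide l) (h' : z ∈ exitSide l') :
    l = l' := by
  have key (h : z ∈ exitSide .L) (h' : z ∈ exitSide .R) : False := by
    rw [mem_exitSide_L] at h
    rw [mem_exitSide_R, h] at h'
    have := z.im_pos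
    nlinarith
  cases l <;> cases l' <;> first | rfl | exact (key h h').elim | exact (key h' h).elim

/-! ### A triangle is determined by a point of its entry side and an inner point -/

/-- The point of the upper half plane with coordinates `x` and `y`. -/
def point (x y : ℝ) (hy : 0 < y) : ℍ := ⟨⟨x, y⟩, hy⟩

lemma point_re (x y : ℝ) (hy : 0 < y) : (point x y hy).re = x := rfl

lemma point_im (x y : ℝ) (hy : 0 < y) : (point x y hy).im = y := rfl

lemma smul_eq_of_diag {g : SL(2, ℝ)} (hb : g 0 1 = 0) (hc : g 1 0 = 0) (z : ℍ) :
    (g • z).re = g 0 0 ^ 2 * z.re ∧ (g • z).im = g 0 0 ^ 2 * z.im := by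
  have h := det_eq g
  obtain ⟨h1, h2⟩ := smul_re_im_aux g z
  simp only [hb, hc, zero_mul, mul_zero, sub_zero, zero_add, add_zero] at h h1 h2
  exact ⟨by linear_combination g 0 0 * h1 - (g • z).re * h,
    by linear_combination g 0 0 * h2 - (g • z).im * h⟩

lemma exists_smul_mem_triangleInterior {g : SL(2, ℝ)} (hb : g 0 1 = 0) (hc : g 1 0 = 0)
    (ha : g 0 0 ^ 2 < 1) : ∃ z ∈ exitSide .L, g • z ∈ triangleInterior := by
  have h := det_eq g
  have h0 : 0 < g 0 0 ^ 2 := by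
    have : g 0 0 ≠ 0 := fun h0 => by simp [hb, h0] at h
    positivity
  set r := g 0 0 ^ 2
  -- The height `1 / r` makes the image `r + i`, which lies in the strip and above the half circle.
  refine ⟨point 1 (1 / r) (by positivity), point_re _ _ _, ?_⟩
  obtain ⟨h1, h2⟩ := smul_eq_of_diag hb hc (point 1 (1 / r) (by positivity))
  rw [mem_triangleInterior, h1, h2, point_re, point_im, mul_one_div_cancel h0.ne']
  refine ⟨by linarith, by linarith, by nlinarith⟩

lemma inv_apply (g : SL(2, ℝ)) : g⁻¹ 0 0 = g 1 1 ∧ g⁻¹ 0 1 = -g 0 1 ∧ g⁻¹ 1 0 = -g 1 0 ∧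
    g⁻¹ 1 1 = g 0 0 := by
  simp [Matrix.adjugate_fin_two]

/-- If the product were nonzero, the image of the axis would cross the axis at `g • p`, and image
points on one side of the crossing would be interior to the triangle, although they come from points
of `X`. -/
lemma offDiag_eq_zero_of_axis {X : Set ℍ} {g : SL(2, ℝ)} (hX : ∀ z ∈ axis, z ∈ X)
    (hg : ∀ z ∈ triangleInterior, g⁻¹ • z ∉ X) {p : ℍ} (hp : p ∈ axis) (hp' : g • p ∈ axis) :
    g 0 0 * g 1 0 = 0 := by
  by_contra hac
  have hdet := det_eq g
  have ha : g 0 0 ≠ 0 := left_ne_zero_of_mul hac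
  have hc : g 1 0 ≠ 0 := right_ne_zero_of_mul hac
  set a := g 0 0
  set b := g 0 1
  set c := g 1 0
  set d := g 1 1
  have h1 := smul_re_mul g p
  rw [mem_axis] at hp hp'
  rw [hp', hp] at h1
  set E₀ := p.im ^ 2 with hE₀
  have hE₀pos : 0 < E₀ := pow_pos p.im_pos 2
  have h0 : a * c * E₀ + b * d = 0 := by linear_combination -h1
  -- In terms of `E = y²`, the real part of `g • (i y)` has numerator `a c E + b d`, which vanishes
  -- at `E₀`. The other two inequalities of the triangle are strict there, so they survive a small
  -- change of `E`; the sign of `a c` tells in which direction to move.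
  have ev : ∀ᶠ E in 𝓝 E₀, 0 < E ∧ a * c * E + b * d < c ^ 2 * E + d ^ 2 ∧
      a * c * E + b * d < a ^ 2 * E + b ^ 2 := by
    refine (lt_mem_nhds hE₀pos).and (Eventually.and ?_ ?_)
    · refine ContinuousAt.eventually_lt (by fun_prop) (by fun_prop) ?_
      rw [h0]; positivity
    · refine ContinuousAt.eventually_lt (by fun_prop) (by fun_prop) ?_
      rw [h0]; positivity
  obtain ⟨E, ⟨hE, h2, h3⟩, h4⟩ : ∃ E, (0 < E ∧ a * c * E + b * d < c ^ 2 * E + d ^ 2 ∧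
      a * c * E + b * d < a ^ 2 * E + b ^ 2) ∧ 0 < a * c * E + b * d := by
    obtain ⟨ε, hε, h⟩ := Metric.eventually_nhds_iff.mp ev
    rcases lt_or_gt_of_ne hac with hac | hac
    · refine ⟨E₀ - ε / 2, h ?_, by nlinarith⟩
      rw [Real.dist_eq, abs_lt]; constructor <;> linarith
    · refine ⟨E₀ + ε / 2, h ?_, by nlinarith⟩
      rw [Real.dist_eq, abs_lt]; constructor <;> linarith
  have hy : 0 < √E := Real.sqrt_pos.mpr hE
  have hy2 : √E ^ 2 = E := Real.sq_sqrt hE.le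
  set z := point 0 (√E) hy
  have hN := denomSq_pos g z
  have h5 := smul_re_mul g z
  have h6 := smul_sq_mul g z
  have hN' : denomSq g z = c ^ 2 * E + d ^ 2 := by
    simp only [denomSq, z, point_re, point_im]; rw [mul_pow, hy2]; ring
  simp only [z, point_re, point_im] at h5 h6
  rw [mul_pow, hy2] at h6
  rw [hy2] at h5
  refine hg (g • z) ?_ (by rw [inv_smul_smul]; exact hX z rfl)
  rw [mem_triangleInterior]
  refine ⟨?_, ?_, ?_⟩
  · refine pos_of_mul_pos_left (b := denomSq g z) ?_ hN.le
    rw [h5]; linarith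
  · refine lt_of_mul_lt_mul_right (a := denomSq g z) ?_ hN.le
    rw [h5, hN']; linarith
  · refine lt_of_mul_lt_mul_right (a := denomSq g z) ?_ hN.le
    rw [h5, h6]; linarith

/-- Such a `g` preserves the axis, and `q` excludes an exchange of its two sides, so `g` is
diagonal. A dilation factor other than `1` would push the line `Re = 1` into the interior of the
triangle, under `g` or under its inverse. -/
lemma smul_eq_self_of_isTriangle {X : Set ℍ} {g : SL(2, ℝ)} (h1 : IsTriangle X 1)
    (hg : IsTriangle X g⁻¹) {p q : ℍ} (hp : p ∈ axis) (hp' : g • p ∈ axis)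
    (hq : q ∈ triangleInterior) (hq' : g • q ∈ triangleInterior) (z : ℍ) : g • z = z := by
  simp only [IsTriangle, one_smul] at h1
  have hac := offDiag_eq_zero_of_axis h1.1 hg.2.2 hp hp'
  have hbd : g 0 1 * g 1 1 = 0 := by
    have h := smul_re_mul g p
    rw [mem_axis] at hp hp'
    rw [hp', hp, hac] at h
    linear_combination -h
  have hdet := det_eq g
  -- If `a = 0` then also `d = 0`, and `g` reverses the sign of the real part of `q`.
  have ha : g 0 0 ≠ 0 := by
    intro ha
    have hb : g 0 1 ≠ 0 := fun hb => by simp [ha, hb] at hdet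
    have hd : g 1 1 = 0 := by simpa [hb] using hbd
    have h := smul_re_mul g q
    have hN := denomSq_pos g q
    rw [ha, hd] at h
    have := mul_pos hq'.1 hN
    have hq1 : 0 < q.re := hq.1
    rw [ha] at hdet
    nlinarith
  have hc : g 1 0 = 0 := by simpa [ha] using hac
  have hb : g 0 1 = 0 := by
    have hd : g 1 1 ≠ 0 := fun hd => by simp [hd, hc] at hdet
    simpa [hd] using hbd
  obtain ⟨i1, i2, i3, i4⟩ := inv_apply g
  have had : g 0 0 * g 1 1 = 1 := by rw [hb] at hdet; linarith
  have ha1 : g 0 0 ^ 2 = 1 := by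
    rcases lt_trichotomy (g 0 0 ^ 2) 1 with h | h | h
    · obtain ⟨w, hw, hw'⟩ := exists_smul_mem_triangleInterior hb hc h
      exact (hg.2.2 _ hw' (by rw [inv_smul_smul]; exact h1.2.1 _ w hw)).elim
    · exact h
    · have h' : g⁻¹ 0 0 ^ 2 < 1 := by
        rw [i1]
        have : g 0 0 ^ 2 * g 1 1 ^ 2 = 1 := by rw [← mul_pow, had, one_pow]
        have hd : g 1 1 ≠ 0 := fun hd => by simp [hd, hc] at hdet
        have : 0 < g 1 1 ^ 2 := by positivity
        nlinarith
      obtain ⟨w, hw, hw'⟩ := exists_smul_mem_triangleInterior (by rw [i2, hb, neg_zero])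
        (by rw [i3, hc, neg_zero]) h'
      exact (h1.2.2 _ hw' (hg.2.1 _ w hw)).elim
  obtain ⟨h2, h3⟩ := smul_eq_of_diag hb hc z
  rw [ha1, one_mul] at h2 h3
  exact UpperHalfPlane.ext (Complex.ext h2 h3)

lemma isTriangle_preimage {X : Set ℍ} (M h : SL(2, ℝ)) :
    IsTriangle {z | M • z ∈ X} h ↔ IsTriangle X (M * h) := by
  simp only [IsTriangle, mul_smul, Set.mem_ofPred_eq]

lemma inv_smul_eq_inv_smul {X : Set ℍ} {h h' : SL(2, ℝ)} (hh : IsTriangle X h)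
    (hh' : IsTriangle X h') {p q : ℍ} (hp : h⁻¹ • p ∈ axis) (hp' : h'⁻¹ • p ∈ axis)
    (hq : h⁻¹ • q ∈ triangleInterior) (hq' : h'⁻¹ • q ∈ triangleInterior) (z : ℍ) :
    h⁻¹ • z = h'⁻¹ • z := by
  have key := smul_eq_self_of_isTriangle (X := {z | h • z ∈ X}) (g := h'⁻¹ * h)
    (by rw [isTriangle_preimage, mul_one]; exact hh)
    (by rw [isTriangle_preimage, mul_inv_rev, inv_inv, mul_inv_cancel_left]; exact hh')
    hp (by rwa [mul_smul, smul_inv_smul]) hq (by rwa [mul_smul, smul_inv_smul]) (h⁻¹ • z)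
  rw [mul_smul, smul_inv_smul] at key
  exact key.symm

/-! ### Cuts are determined by the time of entry -/

/-- Just after `s` both crossings have a common interior point, so the two triangles are the same.
Its interior is disjoint from the exit sides, which fixes the exit time. -/
lemma Cuts.unique {X : Set ℍ} {γ : ℝ → ℍ} {l l' : Letter} {s t t' : ℝ} (h : Cuts X γ l s t)
    (h' : Cuts X γ l' s t') : l = l' ∧ t = t' := by
  obtain ⟨hst, g, hg, h1, h2, h3⟩ := h
  obtain ⟨hst', g', hg', h1', h2', h3'⟩ := h'
  obtain ⟨u, hu, hu'⟩ := exists_between (lt_min hst hst')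
  have key := inv_smul_eq_inv_smul hg hg' h1 h1' (h2 u ⟨hu, hu'.trans_le (min_le_left _ _)⟩)
    (h2' u ⟨hu, hu'.trans_le (min_le_right _ _)⟩)
  have htt : t = t' := by
    rcases lt_trichotomy t t' with h | h | h
    · rw [key] at h3
      exact (not_mem_exitSide (h2' t ⟨hst, h⟩) l h3).elim
    · exact h
    · rw [← key] at h3'
      exact (not_mem_exitSide (h2 t' ⟨hst', h⟩) l' h3').elim
  subst htt
  rw [key] at h3
  exact ⟨exitSide_injective h3 h3', rfl⟩

lemma Cuts.not_endsAtVertex {X : Set ℍ} {γ : ℝ → ℍ} {l : Letter} {s t : ℝ} (h : Cuts X γ l s t) :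
    ¬ EndsAtVertex X γ s := by
  rintro ⟨g', hg', h1', h2', -⟩
  obtain ⟨hst, g, hg, h1, h2, h3⟩ := h
  obtain ⟨u, hu, hu'⟩ := exists_between hst
  have key := inv_smul_eq_inv_smul hg hg' h1 h1' (h2 u ⟨hu, hu'⟩) (h2' u hu)
  rw [key] at h3
  exact not_mem_exitSide (h2' t hst) l h3

lemma cuts_preimage {X : Set ℍ} (M : SL(2, ℝ)) {γ : ℝ → ℍ} {l : Letter} {s t : ℝ} :
    Cuts {z | M • z ∈ X} γ l s t ↔ Cuts X (fun u => M • γ u) l s t := by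
  constructor
  · rintro ⟨hst, h, h1, h2, h3, h4⟩
    refine ⟨hst, M * h, (isTriangle_preimage M h).mp h1, ?_⟩
    simp only [mul_inv_rev, mul_smul, inv_smul_smul]
    exact ⟨h2, h3, h4⟩
  · rintro ⟨hst, h, h1, h2, h3, h4⟩
    refine ⟨hst, M⁻¹ * h, (isTriangle_preimage M _).mpr (by rwa [mul_inv_cancel_left]), ?_⟩
    simp only [mul_inv_rev, mul_smul, inv_inv]
    exact ⟨h2, h3, h4⟩

lemma endsAtVertex_preimage {X : Set ℍ} (M : SL(2, ℝ)) {γ : ℝ → ℍ} {s : ℝ} :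
    EndsAtVertex {z | M • z ∈ X} γ s ↔ EndsAtVertex X (fun u => M • γ u) s := by
  constructor
  · rintro ⟨h, h1, h2, h3, h4⟩
    refine ⟨M * h, (isTriangle_preimage M h).mp h1, ?_⟩
    simp only [mul_inv_rev, mul_smul, inv_smul_smul]
    exact ⟨h2, h3, h4⟩
  · rintro ⟨h, h1, h2, h3, h4⟩
    refine ⟨M⁻¹ * h, (isTriangle_preimage M _).mpr (by rwa [mul_inv_cancel_left]), ?_⟩
    simp only [mul_inv_rev, mul_smul, inv_inv]
    exact ⟨h2, h3, h4⟩

lemma Cuts.congr {X : Set ℍ} {γ γ' : ℝ → ℍ} {l : Letter} {s t : ℝ}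
    (hγ : ∀ u, s ≤ u → γ u = γ' u) (h : Cuts X γ l s t) : Cuts X γ' l s t := by
  obtain ⟨hst, g, hg, h1, h2, h3⟩ := h
  refine ⟨hst, g, hg, hγ s le_rfl ▸ h1, fun u hu => hγ u hu.1.le ▸ h2 u hu, hγ t hst.le ▸ h3⟩

lemma EndsAtVertex.congr {X : Set ℍ} {γ γ' : ℝ → ℍ} {s : ℝ}
    (hγ : ∀ u, s ≤ u → γ u = γ' u) (h : EndsAtVertex X γ s) : EndsAtVertex X γ' s := by
  obtain ⟨g, hg, h1, h2, h3⟩ := h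
  refine ⟨g, hg, hγ s le_rfl ▸ h1, fun u hu => hγ u (le_of_lt hu) ▸ h2 u hu, h3.congr' ?_⟩
  filter_upwards [eventually_ge_atTop s] with u hu
  rw [hγ u hu]

/-! ### The triangle `0, ∞, 1` of the Farey complex -/

lemma smul_mem_farey (A : SL(2, ℤ)) {z : ℍ} : A • z ∈ farey ↔ z ∈ farey := by
  constructor
  · rintro ⟨B, w, hw, h⟩
    exact ⟨A⁻¹ * B, w, hw, by rw [mul_smul, ← h, inv_smul_smul]⟩
  · rintro ⟨B, w, hw, rfl⟩
    exact ⟨A * B, w, hw, by rw [mul_smul]⟩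

lemma preimage_farey (A : SL(2, ℤ)) : {z : ℍ | (A : SL(2, ℝ)) • z ∈ farey} = farey := by
  ext z
  rw [Set.mem_ofPred_eq, coe_int_smul, smul_mem_farey]

/-- The element of `SL(2, ℤ)` that maps the axis to the exit side of type `l` of the triangle
`0, ∞, 1`. -/
def exitMatrix : Letter → SL(2, ℤ)
  | .L => ⟨!![1, 1; 0, 1], by simp [Matrix.det_fin_two_of]⟩
  | .R => ⟨!![1, 0; 1, 1], by simp [Matrix.det_fin_two_of]⟩

/-- The sign conditions that an edge with ends `a / c` and `b / d` would satisfy if it met the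
interior of the triangle `0, ∞, 1`; over the integers they contradict determinant `1`. -/
lemma not_farey_neighbours {a b c d : ℤ} (hdet : a * d - b * c = 1) (h1 : 0 < a * c ∨ 0 < b * d)
    (h2 : 0 < c * (c - a) ∨ 0 < d * (d - b)) (h3 : 0 < a * (a - c) ∨ 0 < b * (b - d)) : False := by
  simp only [mul_pos_iff] at h1 h2 h3
  rcases h1 with (⟨h, h'⟩ | ⟨h, h'⟩) | (⟨h, h'⟩ | ⟨h, h'⟩) <;>
  rcases h2 with (⟨i, i'⟩ | ⟨i, i'⟩) | (⟨i, i'⟩ | ⟨i, i'⟩) <;>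
  rcases h3 with (⟨j, j'⟩ | ⟨j, j'⟩) | (⟨j, j'⟩ | ⟨j, j'⟩) <;>
  first | omega | nlinarith

lemma inv_exitMatrix_L : (((exitMatrix .L)⁻¹ : SL(2, ℤ)) : SL(2, ℝ)).1 = !![1, -1; 0, 1] := by
  have h : ((exitMatrix .L)⁻¹).1 = !![1, -1; 0, 1] := by
    rw [Matrix.SpecialLinearGroup.SL2_inv_expl]
    simp [exitMatrix]
    rfl
  change ((exitMatrix .L)⁻¹).1.map (Int.cast : ℤ → ℝ) = _
  rw [h]
  ext i j
  fin_cases i <;> fin_cases j <;> simp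

lemma inv_exitMatrix_R : (((exitMatrix .R)⁻¹ : SL(2, ℤ)) : SL(2, ℝ)).1 = !![1, 0; -1, 1] := by
  have h : ((exitMatrix .R)⁻¹).1 = !![1, 0; -1, 1] := by
    rw [Matrix.SpecialLinearGroup.SL2_inv_expl]
    simp [exitMatrix]
    rfl
  change ((exitMatrix .R)⁻¹).1.map (Int.cast : ℤ → ℝ) = _
  rw [h]
  ext i j
  fin_cases i <;> fin_cases j <;> simp

lemma exitSide_subset_farey (l : Letter) {z : ℍ} (hz : z ∈ exitSide l) : z ∈ farey := by
  refine ⟨exitMatrix l, (exitMatrix l)⁻¹ • z, ?_, by rw [smul_inv_smul]⟩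
  rw [← coe_int_smul, mem_axis]
  have hN := denomSq_pos ((exitMatrix l)⁻¹ : SL(2, ℤ)) z
  have h1 := smul_re_mul ((exitMatrix l)⁻¹ : SL(2, ℤ)) z
  refine (mul_eq_zero_iff_right hN.ne').mp (h1.trans ?_)
  cases l
  · rw [mem_exitSide_L] at hz
    rw [inv_exitMatrix_L]
    simp [hz]
  · rw [mem_exitSide_R] at hz
    rw [inv_exitMatrix_R]
    simp [hz]

lemma isTriangle_farey_one : IsTriangle farey 1 := by
  simp only [IsTriangle, one_smul]
  refine ⟨fun z hz => ⟨1, z, hz, by rw [one_smul]⟩, fun l z hz => exitSide_subset_farey l hz, ?_⟩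
  rintro z hz ⟨A, w, hw, rfl⟩
  rw [mem_triangleInterior, ← coe_int_smul] at hz
  obtain ⟨hz1, hz2, hz3⟩ := hz
  have hN := denomSq_pos A w
  have h1 := smul_re_mul A w
  have h2 := smul_sq_mul A w
  have hdet : A 0 0 * A 1 1 - A 0 1 * A 1 0 = 1 := by
    rw [← Matrix.det_fin_two, A.det_coe]
  have h3 : denomSq A w = (A 1 0 : ℝ) ^ 2 * w.im ^ 2 + (A 1 1 : ℝ) ^ 2 := by
    rw [mem_axis] at hw
    simp only [denomSq, hw, mul_zero, zero_add, mul_pow]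
    exact add_comm _ _
  rw [mem_axis] at hw
  simp only [hw, mul_zero, zero_add, add_zero, mul_pow] at h1 h2
  change _ = (A 0 0 : ℝ) * (A 1 0 : ℝ) * _ + (A 0 1 : ℝ) * (A 1 1 : ℝ) at h1
  change _ = (A 0 1 : ℝ) ^ 2 + (A 0 0 : ℝ) ^ 2 * _ at h2
  have hE : 0 < w.im ^ 2 := pow_pos w.im_pos 2
  -- Each inequality of the triangle is affine in `y²` with integer coefficients; being positive at
  -- a positive value, it has a positive coefficient.
  have pos_or {p q : ℤ} (h : 0 < (p : ℝ) * w.im ^ 2 + q) : 0 < p ∨ 0 < q := by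
    by_contra! hpq
    have hp : (p : ℝ) ≤ 0 := by exact_mod_cast hpq.1
    have hq : (q : ℝ) ≤ 0 := by exact_mod_cast hpq.2
    nlinarith
  have e1 := mul_pos hz1 hN
  have e2 := mul_lt_mul_of_pos_right hz2 hN
  have e3 := mul_lt_mul_of_pos_right hz3 hN
  rw [h1] at e1 e2 e3
  rw [h3] at e2
  rw [h2] at e3
  refine not_farey_neighbours hdet (pos_or ?_) (pos_or ?_) (pos_or ?_) <;> push_cast <;> linarith

/-! ### Geodesics that enter the triangle `0, ∞, 1` -/

/-- At time `s` the geodesic of `g` crosses the `y`-axis, on its way to the positive end `x`. -/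
def Enters (g : SL(2, ℝ)) (s x : ℝ) : Prop :=
  0 < x ∧ g 1 0 ≠ 0 ∧ g 0 0 = x * g 1 0 ∧ x * g 1 0 ^ 2 * Real.exp (2 * s) + g 0 1 * g 1 1 = 0

lemma axisPoint_re (t : ℝ) : (axisPoint t).re = 0 := by simp [axisPoint, UpperHalfPlane.re]

lemma axisPoint_im (t : ℝ) : (axisPoint t).im = Real.exp t := by
  simp [axisPoint, UpperHalfPlane.im, Complex.exp_ofReal_re]

lemma axisPoint_im_sq (t : ℝ) : (axisPoint t).im ^ 2 = Real.exp (2 * t) := by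
  rw [axisPoint_im, ← Real.exp_nat_mul]; norm_num

lemma denomSq_axisPoint (g : SL(2, ℝ)) (t : ℝ) :
    denomSq g (axisPoint t) = g 1 0 ^ 2 * Real.exp (2 * t) + g 1 1 ^ 2 := by
  rw [denomSq, axisPoint_re, mul_pow, axisPoint_im_sq]; ring

lemma geodesic_re (g : SL(2, ℝ)) (t : ℝ) : (geodesic g t).re * denomSq g (axisPoint t) =
    g 0 0 * g 1 0 * Real.exp (2 * t) + g 0 1 * g 1 1 := by
  rw [geodesic, smul_re_mul, axisPoint_re, axisPoint_im_sq]; ring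

lemma geodesic_sq (g : SL(2, ℝ)) (t : ℝ) :
    ((geodesic g t).re ^ 2 + (geodesic g t).im ^ 2) * denomSq g (axisPoint t) =
      g 0 0 ^ 2 * Real.exp (2 * t) + g 0 1 ^ 2 := by
  rw [geodesic, smul_sq_mul, axisPoint_re, mul_pow, axisPoint_im_sq]; ring

namespace Enters

variable {g : SL(2, ℝ)} {s x : ℝ}

lemma mem_axis (h : Enters g s x) : geodesic g s ∈ axis := by
  obtain ⟨-, -, ha, h0⟩ := h
  refine (mul_eq_zero_iff_right (denomSq_pos g (axisPoint s)).ne').mp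
    ((geodesic_re g s).trans ?_)
  rw [ha]
  linear_combination h0

/-- The signs of the products of the entries of the second column and the lower left entry. -/
lemma signs (h : Enters g s x) : 0 < g 1 0 * g 1 1 ∧ g 1 0 * g 0 1 < 0 := by
  obtain ⟨hx, hc, ha, h0⟩ := h
  have hdet := det_eq g
  rw [ha] at hdet
  set b := g 0 1
  set c := g 1 0
  set d := g 1 1
  have h1 : (c * d) * (c * b) < 0 := by
    have : (c * d) * (c * b) = - (x * c ^ 4 * Real.exp (2 * s)) := by
      linear_combination c ^ 2 * h0
    rw [this]
    have := Real.exp_pos (2 * s)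
    have : 0 < c ^ 4 := by positivity
    have : 0 < x * c ^ 4 * Real.exp (2 * s) := by positivity
    linarith
  -- By the determinant, `c b = x (c d) - 1`. If `c d ≤ 0`, both factors are nonpositive, against
  -- the negative product `h1`.
  have hu : 0 < c * d := by
    by_contra! hu
    have : c * b = x * (c * d) - 1 := by linarith
    nlinarith [mul_nonneg hx.le (neg_nonneg.mpr hu)]
  exact ⟨hu, by nlinarith⟩

lemma re_pos (h : Enters g s x) {u : ℝ} (hu : s < u) : 0 < (geodesic g u).re := by
  obtain ⟨hx, hc, ha, h0⟩ := h
  refine pos_of_mul_pos_left (b := denomSq g (axisPoint u)) ?_ (denomSq_pos _ _).le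
  rw [geodesic_re, ha]
  have : Real.exp (2 * s) < Real.exp (2 * u) := Real.exp_lt_exp.mpr (by linarith)
  have h2 : 0 < x * g 1 0 ^ 2 := by positivity
  nlinarith

/-- These are the constant terms of the affine functions of `exp (2 u)` below. Their signs reflect
that the backward end `b / d` of the geodesic is negative. -/
lemma mul_sub_neg (h : Enters g s x) : (g 0 1 - g 1 1) * g 1 1 < 0 ∧
    0 < g 0 1 * (g 0 1 - g 1 1) := by
  obtain ⟨h1, h2⟩ := h.signs
  have hc : 0 < g 1 0 ^ 2 := by have := h.2.1; positivity
  constructor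
  · refine neg_of_mul_neg_right (a := g 1 0 ^ 2) ?_ hc.le
    nlinarith
  · refine pos_of_mul_pos_right (a := g 1 0 ^ 2) ?_ hc.le
    nlinarith

lemma re_lt_one_iff (h : Enters g s x) (u : ℝ) : (geodesic g u).re < 1 ↔
    (x - 1) * g 1 0 ^ 2 * Real.exp (2 * u) + (g 0 1 - g 1 1) * g 1 1 < 0 := by
  rw [← mul_lt_mul_iff_left₀ (denomSq_pos g (axisPoint u)), geodesic_re, denomSq_axisPoint,
    h.2.2.1, ← sub_neg]
  ring_nf

lemma re_eq_one_iff (h : Enters g s x) (u : ℝ) : (geodesic g u).re = 1 ↔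
    (x - 1) * g 1 0 ^ 2 * Real.exp (2 * u) + (g 0 1 - g 1 1) * g 1 1 = 0 := by
  rw [← mul_left_inj' (denomSq_pos g (axisPoint u)).ne', geodesic_re, denomSq_axisPoint,
    h.2.2.1, ← sub_eq_zero]
  ring_nf

lemma re_lt_sq_iff (h : Enters g s x) (u : ℝ) :
    (geodesic g u).re < (geodesic g u).re ^ 2 + (geodesic g u).im ^ 2 ↔
    x * (1 - x) * g 1 0 ^ 2 * Real.exp (2 * u) - g 0 1 * (g 0 1 - g 1 1) < 0 := by
  rw [← mul_lt_mul_iff_left₀ (denomSq_pos g (axisPoint u)), geodesic_re, geodesic_sq,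
    h.2.2.1, ← sub_neg]
  ring_nf

lemma sq_eq_re_iff (h : Enters g s x) (u : ℝ) :
    (geodesic g u).re ^ 2 + (geodesic g u).im ^ 2 = (geodesic g u).re ↔
    x * (1 - x) * g 1 0 ^ 2 * Real.exp (2 * u) - g 0 1 * (g 0 1 - g 1 1) = 0 := by
  rw [eq_comm, ← mul_left_inj' (denomSq_pos g (axisPoint u)).ne', geodesic_re, geodesic_sq,
    h.2.2.1, ← sub_eq_zero]
  ring_nf

lemma exists_cuts_L (h : Enters g s x) (hx : 1 < x) : ∃ t, Cuts farey (geodesic g) .L s t ∧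
    Enters (((exitMatrix .L)⁻¹ : SL(2, ℤ)) * g) t (x - 1) := by
  obtain ⟨h1, h2⟩ := h.mul_sub_neg
  have hk : 0 < (x - 1) * g 1 0 ^ 2 := by
    have := h.2.1
    have : 0 < x - 1 := by linarith
    positivity
  -- The exit time `t` is the unique zero of the affine function of `exp (2 u)` that measures the
  -- passage through `Re = 1`; its slope is positive as `x > 1`. The half circle is never reached,
  -- since its function has negative slope and negative constant term.
  have hE : 0 < -((g 0 1 - g 1 1) * g 1 1) / ((x - 1) * g 1 0 ^ 2) := div_pos (by linarith) hk
  set t := Real.log (-((g 0 1 - g 1 1) * g 1 1) / ((x - 1) * g 1 0 ^ 2)) / 2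
  have ht : (x - 1) * g 1 0 ^ 2 * Real.exp (2 * t) + (g 0 1 - g 1 1) * g 1 1 = 0 := by
    rw [mul_div_cancel₀ _ two_ne_zero, Real.exp_log hE, mul_div_cancel₀ _ hk.ne']
    ring
  have lt_iff (u : ℝ) : (geodesic g u).re < 1 ↔ u < t := by
    rw [h.re_lt_one_iff, ← ht, add_lt_add_iff_right, mul_lt_mul_iff_right₀ hk, Real.exp_lt_exp]
    constructor <;> intro <;> linarith
  refine ⟨t, ⟨?_, 1, isTriangle_farey_one, ?_, fun u hu => ?_, ?_⟩, ?_⟩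
  · rw [← lt_iff, CuttingSeq.mem_axis.mp h.mem_axis]; exact one_pos
  · rw [inv_one, one_smul]; exact h.mem_axis
  · rw [inv_one, one_smul, mem_triangleInterior]
    refine ⟨h.re_pos hu.1, (lt_iff u).mpr hu.2, (h.re_lt_sq_iff u).mpr ?_⟩
    have : 0 < x * ((x - 1) * g 1 0 ^ 2) * Real.exp (2 * u) :=
      mul_pos (mul_pos h.1 hk) (Real.exp_pos _)
    nlinarith
  · rw [inv_one, one_smul, mem_exitSide_L, h.re_eq_one_iff, ht]
  · have e := Matrix.SpecialLinearGroup.coe_mul (((exitMatrix .L)⁻¹ : SL(2, ℤ)) : SL(2, ℝ)) g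
    rw [inv_exitMatrix_L, Matrix.eta_fin_two g.1] at e
    rw [Enters, e]
    simp only [Matrix.mul_fin_two, Matrix.of_apply, Matrix.cons_val_zero, Matrix.cons_val_one]
    refine ⟨by linarith, by simpa using h.2.1, ?_, ?_⟩
    · rw [h.2.2.1]; ring
    · linear_combination ht

lemma exists_cuts_R (h : Enters g s x) (hx : x < 1) : ∃ t, Cuts farey (geodesic g) .R s t ∧
    Enters (((exitMatrix .R)⁻¹ : SL(2, ℤ)) * g) t (x / (1 - x)) := by
  obtain ⟨h1, h2⟩ := h.mul_sub_neg
  have hx1 : 0 < 1 - x := by linarith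
  have hk : 0 < x * (1 - x) * g 1 0 ^ 2 := by
    have := h.2.1
    have := h.1
    positivity
  -- As before, with the half circle as the exit side; now `x < 1` keeps the real part below `1` at
  -- all times.
  have hE : 0 < g 0 1 * (g 0 1 - g 1 1) / (x * (1 - x) * g 1 0 ^ 2) := div_pos (by linarith) hk
  set t := Real.log (g 0 1 * (g 0 1 - g 1 1) / (x * (1 - x) * g 1 0 ^ 2)) / 2
  have ht : x * (1 - x) * g 1 0 ^ 2 * Real.exp (2 * t) - g 0 1 * (g 0 1 - g 1 1) = 0 := by
    rw [mul_div_cancel₀ _ two_ne_zero, Real.exp_log hE, mul_div_cancel₀ _ hk.ne']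
    ring
  have lt_iff (u : ℝ) : (geodesic g u).re < (geodesic g u).re ^ 2 + (geodesic g u).im ^ 2 ↔
      u < t := by
    rw [h.re_lt_sq_iff, ← ht, sub_lt_sub_iff_right, mul_lt_mul_iff_right₀ hk, Real.exp_lt_exp]
    constructor <;> intro <;> linarith
  refine ⟨t, ⟨?_, 1, isTriangle_farey_one, ?_, fun u hu => ?_, ?_⟩, ?_⟩
  · have := (geodesic g s).im_pos
    rw [← lt_iff, CuttingSeq.mem_axis.mp h.mem_axis]; positivity
  · rw [inv_one, one_smul]; exact h.mem_axis
  · rw [inv_one, one_smul, mem_triangleInterior]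
    refine ⟨h.re_pos hu.1, (h.re_lt_one_iff u).mpr ?_, (lt_iff u).mpr hu.2⟩
    have := h.2.1
    have : 0 < (1 - x) * g 1 0 ^ 2 * Real.exp (2 * u) := by positivity
    nlinarith
  · rw [inv_one, one_smul, mem_exitSide_R, h.sq_eq_re_iff, ht]
  · have e := Matrix.SpecialLinearGroup.coe_mul (((exitMatrix .R)⁻¹ : SL(2, ℤ)) : SL(2, ℝ)) g
    rw [inv_exitMatrix_R, Matrix.eta_fin_two g.1] at e
    rw [Enters, e]
    simp only [Matrix.mul_fin_two, Matrix.of_apply, Matrix.cons_val_zero, Matrix.cons_val_one]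
    have hc : -1 * g 0 0 + 1 * g 1 0 = (1 - x) * g 1 0 := by rw [h.2.2.1]; ring
    rw [hc]
    refine ⟨div_pos h.1 hx1, mul_ne_zero hx1.ne' h.2.1, ?_, ?_⟩
    · rw [h.2.2.1]; field_simp; ring
    · have : x / (1 - x) * ((1 - x) * g 1 0) ^ 2 = x * (1 - x) * g 1 0 ^ 2 := by
        field_simp
      rw [this]
      linear_combination ht

end Enters

/-- Dividing numerator and denominator by `exp t` leaves `(a i + b exp (-t)) / (c i + d exp (-t))`.
-/
lemma tendsto_geodesic {g : SL(2, ℝ)} (hc : g 1 0 ≠ 0) :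
    Tendsto (fun t => (geodesic g t : ℂ)) atTop (𝓝 ((g 0 0 / g 1 0 : ℝ) : ℂ)) := by
  have h0 : Tendsto (fun t : ℝ => ((Real.exp (-t) : ℝ) : ℂ)) atTop (𝓝 ((0 : ℝ) : ℂ)) :=
    (Complex.continuous_ofReal.tendsto 0).comp (Real.tendsto_exp_neg_atTop_nhds_zero)
  have h1 : Tendsto (fun t : ℝ => ((g 0 0 : ℂ) * Complex.I + g 0 1 * (Real.exp (-t) : ℝ)) /
      ((g 1 0 : ℂ) * Complex.I + g 1 1 * (Real.exp (-t) : ℝ))) atTop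
      (𝓝 (((g 0 0 : ℂ) * Complex.I + g 0 1 * (0 : ℝ)) /
        ((g 1 0 : ℂ) * Complex.I + g 1 1 * (0 : ℝ)))) :=
    ((h0.const_mul _).const_add _).div ((h0.const_mul _).const_add _) (by simpa using hc)
  have h2 : ((g 0 0 : ℂ) * Complex.I + g 0 1 * (0 : ℝ)) /
        ((g 1 0 : ℂ) * Complex.I + g 1 1 * (0 : ℝ)) = ((g 0 0 / g 1 0 : ℝ) : ℂ) := by
    push_cast
    rw [mul_zero, add_zero, mul_zero, add_zero, mul_div_mul_right _ _ Complex.I_ne_zero]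
  rw [← h2]
  refine h1.congr fun t => ?_
  have he : (Real.exp t : ℂ) ≠ 0 := by exact_mod_cast (Real.exp_pos t).ne'
  have he' : (Real.exp t : ℂ) * (Real.exp (-t) : ℝ) = 1 := by
    rw [← Complex.ofReal_mul, ← Real.exp_add]; simp
  rw [geodesic, coe_specialLinearGroup_apply, ← mul_div_mul_left _ _ he]
  have h3 : ((axisPoint t : ℍ) : ℂ) = Real.exp t * Complex.I := rfl
  rw [h3]
  congr 1
  · simp only [Algebra.algebraMap_self, RingHom.id_apply]
    linear_combination (g 0 1 : ℂ) * he'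
  · simp only [Algebra.algebraMap_self, RingHom.id_apply]
    linear_combination (g 1 1 : ℂ) * he'

/-- For `x = 1` both slopes vanish, so the two inequalities of the triangle hold for all time. -/
lemma Enters.endsAtVertex {g : SL(2, ℝ)} {s : ℝ} (h : Enters g s 1) :
    EndsAtVertex farey (geodesic g) s := by
  obtain ⟨h1, h2⟩ := h.mul_sub_neg
  refine ⟨1, isTriangle_farey_one, ?_, fun u hu => ?_, ?_⟩
  · rw [inv_one, one_smul]; exact h.mem_axis
  · rw [inv_one, one_smul, mem_triangleInterior]
    refine ⟨h.re_pos hu, (h.re_lt_one_iff u).mpr ?_, (h.re_lt_sq_iff u).mpr ?_⟩ <;> linarith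
  · simp only [inv_one, one_smul]
    have := tendsto_geodesic h.2.1
    rwa [h.2.2.1, one_mul, div_self h.2.1, Complex.ofReal_one] at this

lemma lower_left_ne_zero {g : SL(2, ℝ)} {x : ℝ}
    (h : Tendsto (fun t => (geodesic g t : ℂ)) atTop (𝓝 (x : ℂ))) : g 1 0 ≠ 0 := by
  intro hc
  have hdet := det_eq g
  have hd : g 1 1 ≠ 0 := fun hd => by simp [hd, hc] at hdet
  have h1 : Tendsto (fun t => (geodesic g t).im) atTop (𝓝 0) := by
    have := (Complex.continuous_im.tendsto _).comp h
    rwa [Complex.ofReal_im] at this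
  have h2 := h1.mul_const (g 1 1 ^ 2)
  have h3 : (fun t => (geodesic g t).im * g 1 1 ^ 2) = Real.exp := by
    ext t
    have := smul_im_mul g (axisPoint t)
    rw [denomSq_axisPoint, hc, axisPoint_im] at this
    rw [geodesic, ← this]; ring
  rw [h3] at h2
  exact not_tendsto_nhds_of_tendsto_atTop Real.tendsto_exp_atTop _ h2

lemma enters_of_tendsto {g : SL(2, ℝ)} {x : ℝ} (hx : 0 < x) (h0 : geodesic g 0 ∈ axis)
    (h : Tendsto (fun t => (geodesic g t : ℂ)) atTop (𝓝 (x : ℂ))) : Enters g 0 x := by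
  have hc := lower_left_ne_zero h
  have hx' : g 0 0 / g 1 0 = x :=
    Complex.ofReal_injective (tendsto_nhds_unique (tendsto_geodesic hc) h)
  have ha : g 0 0 = x * g 1 0 := by rw [← hx', div_mul_cancel₀ _ hc]
  refine ⟨hx, hc, ha, ?_⟩
  have h1 := geodesic_re g 0
  rw [mem_axis.mp h0, zero_mul, ha] at h1
  linear_combination -h1

/-! ### The cutting sequence with the Farey complex -/

lemma geodesic_mul (g g' : SL(2, ℝ)) : geodesic (g * g') = fun u => g • geodesic g' u := by
  ext u : 1
  exact mul_smul _ _ _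

lemma cuts_farey_int_mul (A : SL(2, ℤ)) {g : SL(2, ℝ)} {l : Letter} {s t : ℝ} :
    Cuts farey (geodesic ((A : SL(2, ℝ)) * g)) l s t ↔ Cuts farey (geodesic g) l s t := by
  rw [geodesic_mul, ← cuts_preimage, preimage_farey]

lemma endsAtVertex_farey_int_mul (A : SL(2, ℤ)) {g : SL(2, ℝ)} {s : ℝ} :
    EndsAtVertex farey (geodesic ((A : SL(2, ℝ)) * g)) s ↔ EndsAtVertex farey (geodesic g) s := by
  rw [geodesic_mul, ← endsAtVertex_preimage, preimage_farey]

/-- `τ` lists the times at which the ray with end `x` enters the triangles on its way. -/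
def IsItinerary (cuts : Letter → ℝ → ℝ → Prop) (ends : ℝ → Prop) (x : ℝ) (τ : ℕ → ℝ) : Prop :=
  τ 0 = 0 ∧ ∀ k, (1 < fareyMap^[k] x → cuts .L (τ k) (τ (k + 1))) ∧
    (fareyMap^[k] x < 1 → cuts .R (τ k) (τ (k + 1))) ∧ (fareyMap^[k] x = 1 → ends (τ k))

lemma exists_next (g : SL(2, ℝ)) (s x : ℝ) (h : Enters g s x) :
    ∃ (A : SL(2, ℤ)) (t : ℝ), Enters ((A : SL(2, ℝ)) * g) t (fareyMap x) ∧
      (1 < x → Cuts farey (geodesic g) .L s t) ∧ (x < 1 → Cuts farey (geodesic g) .R s t) := by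
  rcases lt_trichotomy x 1 with hx | rfl | hx
  · obtain ⟨t, h1, h2⟩ := h.exists_cuts_R hx
    exact ⟨_, t, by rwa [fareyMap_of_lt_one hx], fun h => by linarith, fun _ => h1⟩
  -- At the fixed point `1` nothing more is cut; repeating the state lets the recursion go on.
  · refine ⟨1, s, ?_, fun h => by linarith, fun h => by linarith⟩
    simpa [fareyMap] using h
  · obtain ⟨t, h1, h2⟩ := h.exists_cuts_L hx
    exact ⟨_, t, by rwa [fareyMap_of_one_lt hx], fun _ => h1, fun h => by linarith⟩

lemma Enters.exists_isItinerary {g : SL(2, ℝ)} {x : ℝ} (h : Enters g 0 x) :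
    ∃ τ, IsItinerary (Cuts farey (geodesic g)) (EndsAtVertex farey (geodesic g)) x τ := by
  -- A state consists of the integer matrix that brings the current entry side to the axis, the
  -- entry time and the moved end. The cuts pull back to the original geodesic because the Farey
  -- complex is invariant.
  have step (p : {p : SL(2, ℤ) × ℝ × ℝ // Enters ((p.1 : SL(2, ℝ)) * g) p.2.1 p.2.2}) :
      ∃ q : {p : SL(2, ℤ) × ℝ × ℝ // Enters ((p.1 : SL(2, ℝ)) * g) p.2.1 p.2.2},
        q.1.2.2 = fareyMap p.1.2.2 ∧
        (1 < p.1.2.2 → Cuts farey (geodesic g) .L p.1.2.1 q.1.2.1) ∧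
        (p.1.2.2 < 1 → Cuts farey (geodesic g) .R p.1.2.1 q.1.2.1) := by
    obtain ⟨⟨B, s, y⟩, hp⟩ := p
    obtain ⟨A, t, h1, h2, h3⟩ := exists_next _ _ _ hp
    simp only [cuts_farey_int_mul] at h2 h3
    refine ⟨⟨(A * B, t, fareyMap y), ?_⟩, rfl, h2, h3⟩
    simpa [mul_assoc] using h1
  choose next hnext using step
  let p₀ : {p : SL(2, ℤ) × ℝ × ℝ // Enters ((p.1 : SL(2, ℝ)) * g) p.2.1 p.2.2} :=
    ⟨(1, 0, x), by simpa using h⟩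
  have hval (k : ℕ) : (next^[k] p₀).1.2.2 = fareyMap^[k] x := by
    induction k with
    | zero => rfl
    | succ k ih => rw [Function.iterate_succ_apply', Function.iterate_succ_apply', ← ih,
        (hnext _).1]
  refine ⟨fun k => (next^[k] p₀).1.2.1, rfl, fun k => ?_⟩
  simp only [← hval k, Function.iterate_succ_apply']
  refine ⟨(hnext _).2.1, (hnext _).2.2, fun h1 => ?_⟩
  have h2 := (next^[k] p₀).2
  rw [h1] at h2
  exact (endsAtVertex_farey_int_mul _).mp h2.endsAtVertex

lemma IsItinerary.isCuttingWord_iff {cuts : Letter → ℝ → ℝ → Prop} {ends : ℝ → Prop} {x : ℝ}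
    {τ : ℕ → ℝ} (h : IsItinerary cuts ends x τ)
    (huniq : ∀ l l' s t t', cuts l s t → cuts l' s t' → l = l' ∧ t = t')
    (hends : ∀ l s t, cuts l s t → ¬ ends s) (w : Stream'.Seq Letter) :
    IsCuttingWord cuts ends w ↔ IsFareyWord x w := by
  constructor
  · rintro ⟨t, ht0, hw0, hw⟩
    -- The times agree only while the word lasts; beyond its end they are unconstrained.
    have key (k : ℕ) (hk : w.get? k ≠ none) : t k = τ k := by
      induction k with
      | zero => rw [ht0, h.1]
      | succ k ih =>
        have hk' := get?_ne_none_of_le k.le_succ hk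
        obtain ⟨l, hl⟩ := Option.ne_none_iff_exists'.mp hk'
        have hc : cuts l (τ k) (t (k + 1)) := by
          rw [← ih hk']
          exact ((hw k l hl).resolve_right fun h => hk h.2).1
        obtain ⟨h1, h2, h3⟩ := h.2 k
        rcases lt_trichotomy (fareyMap^[k] x) 1 with hx | hx | hx
        · exact (huniq _ _ _ _ _ hc (h2 hx)).2
        · exact (hends _ _ _ hc (h3 hx)).elim
        · exact (huniq _ _ _ _ _ hc (h1 hx)).2
    refine ⟨hw0, fun k l hl => ?_⟩
    have hk := hw k l hl
    rw [key k (by simp [hl])] at hk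
    obtain ⟨h1, h2, h3⟩ := h.2 k
    rcases hk with ⟨hc, hk⟩ | ⟨he, hk⟩
    · refine .inl ⟨?_, hk⟩
      rcases lt_trichotomy (fareyMap^[k] x) 1 with hx | hx | hx
      · exact .inr ⟨(huniq _ _ _ _ _ hc (h2 hx)).1, hx⟩
      · exact (hends _ _ _ hc (h3 hx)).elim
      · exact .inl ⟨(huniq _ _ _ _ _ hc (h1 hx)).1, hx⟩
    · refine .inr ⟨?_, hk⟩
      rcases lt_trichotomy (fareyMap^[k] x) 1 with hx | hx | hx
      · exact (hends _ _ _ (h2 hx) he).elim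
      · exact hx
      · exact (hends _ _ _ (h1 hx) he).elim
  · rintro ⟨hw0, hw⟩
    refine ⟨τ, h.1, hw0, fun k l hl => ?_⟩
    obtain ⟨h1, h2, h3⟩ := h.2 k
    rcases hw k l hl with ⟨⟨rfl, hx⟩ | ⟨rfl, hx⟩, hk⟩ | ⟨hx, hk⟩
    · exact .inl ⟨h1 hx, hk⟩
    · exact .inl ⟨h2 hx, hk⟩
    · exact .inr ⟨h3 hx, hk⟩

theorem Enters.mem_cuttingSequence_iff {g : SL(2, ℝ)} {x : ℝ} (h : Enters g 0 x)
    (w : Stream'.Seq Letter) :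
    w ∈ cuttingSequence farey (geodesic g) ↔ IsFareyWord x w := by
  obtain ⟨τ, hτ⟩ := h.exists_isItinerary
  exact hτ.isCuttingWord_iff (fun _ _ _ _ _ h h' => h.unique h')
    (fun _ _ _ h => h.not_endsAtVertex) w

/-! ### Scaling -/

/-- The isometry `z ↦ d z`. -/
def scaling (d : ℕ) (hd : 0 < d) : SL(2, ℝ) :=
  ⟨!![√d, 0; 0, 1 / √d], by
    have : √(d : ℝ) ≠ 0 := (Real.sqrt_pos.mpr (Nat.cast_pos.mpr hd)).ne'
    rw [Matrix.det_fin_two_of, mul_one_div_cancel this]; simp⟩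

lemma coe_scaling_smul {d : ℕ} (hd : 0 < d) (z : ℍ) :
    ((scaling d hd • z : ℍ) : ℂ) = d * (z : ℂ) := by
  have h : (scaling d hd) 0 0 ^ 2 = d := Real.sq_sqrt (Nat.cast_nonneg d)
  obtain ⟨h1, h2⟩ := smul_eq_of_diag (g := scaling d hd) rfl rfl z
  rw [h] at h1 h2
  apply Complex.ext
  · simpa using h1
  · simpa using h2

lemma mem_scaledFarey_iff {d : ℕ} (hd : 0 < d) (z : ℍ) :
    z ∈ scaledFarey d ↔ scaling d hd • z ∈ farey := by
  have hd' : (d : ℂ) ≠ 0 := Nat.cast_ne_zero.mpr hd.ne'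
  constructor
  · rintro ⟨w, hw, h⟩
    have : scaling d hd • z = w := by
      ext
      rw [coe_scaling_smul, h, mul_div_cancel₀ _ hd']
    rwa [this]
  · intro h
    exact ⟨_, h, by rw [coe_scaling_smul, mul_div_cancel_left₀ _ hd']⟩

lemma scaledFarey_eq {d : ℕ} (hd : 0 < d) : scaledFarey d = {z | scaling d hd • z ∈ farey} :=
  Set.ext (mem_scaledFarey_iff hd)

lemma cuttingSequence_scaledFarey {d : ℕ} (hd : 0 < d) (g : SL(2, ℝ)) :
    cuttingSequence (scaledFarey d) (geodesic g) =
      cuttingSequence farey (geodesic (scaling d hd * g)) := by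
  have h1 : Cuts (scaledFarey d) (geodesic g) = Cuts farey (geodesic (scaling d hd * g)) := by
    ext l s t
    rw [scaledFarey_eq hd, geodesic_mul]
    exact cuts_preimage _
  have h2 : EndsAtVertex (scaledFarey d) (geodesic g) =
      EndsAtVertex farey (geodesic (scaling d hd * g)) := by
    ext s
    rw [scaledFarey_eq hd, geodesic_mul]
    exact endsAtVertex_preimage _
  rw [cuttingSequence, cuttingSequence, h1, h2]

lemma enters_scaling_mul {d : ℕ} (hd : 0 < d) {g : SL(2, ℝ)} {x : ℝ} (hx : 0 < x)
    (h0 : geodesic g 0 ∈ axis) (h : Tendsto (fun t => (geodesic g t : ℂ)) atTop (𝓝 (x : ℂ))) :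
    Enters (scaling d hd * g) 0 (d * x) := by
  refine enters_of_tendsto (mul_pos (Nat.cast_pos.mpr hd) hx) ?_ ?_
  · rw [geodesic_mul, mem_axis, (smul_eq_of_diag (g := scaling d hd) rfl rfl _).1,
      mem_axis.mp h0, mul_zero]
  · simp only [geodesic_mul, coe_scaling_smul]
    push_cast
    exact h.const_mul _

/-! ### The action of `Γ₀(n)` -/

/-- Conjugation by `z ↦ d z` multiplies the upper right entry by `d` and divides the lower left one
by `d`; the result is integral because `d ∣ n` and `n` divides the lower left entry. -/
lemma smul_mem_scaledFarey {n d : ℕ} (hd : 0 < d) (hdn : d ∣ n) {A : SL(2, ℤ)}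
    (hA : A ∈ CongruenceSubgroup.Gamma0 n) {z : ℍ} (hz : z ∈ scaledFarey d) :
    A • z ∈ scaledFarey d := by
  rw [CongruenceSubgroup.Gamma0_mem, ZMod.intCast_zmod_eq_zero_iff_dvd] at hA
  obtain ⟨c, hc⟩ : (d : ℤ) ∣ A 1 0 := (Int.natCast_dvd_natCast.mpr hdn).trans hA
  have hdet : A 0 0 * A 1 1 - A 0 1 * A 1 0 = 1 := by
    rw [← Matrix.det_fin_two, A.det_coe]
  let B : SL(2, ℤ) := ⟨!![A 0 0, d * A 0 1; c, A 1 1], by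
    rw [Matrix.det_fin_two_of]; rw [hc] at hdet; linear_combination hdet⟩
  rw [mem_scaledFarey_iff hd] at hz ⊢
  have h : scaling d hd • A • z = B • scaling d hd • z := by
    have hd' : (d : ℂ) ≠ 0 := Nat.cast_ne_zero.mpr hd.ne'
    ext
    rw [coe_scaling_smul, coe_specialLinearGroup_apply, coe_specialLinearGroup_apply,
      coe_scaling_smul, ← mul_div_assoc]
    have e1 : B 0 0 = A 0 0 := rfl
    have e2 : B 0 1 = d * A 0 1 := rfl
    have e3 : B 1 0 = c := rfl
    have e4 : B 1 1 = A 1 1 := rfl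
    rw [e1, e2, e3, e4, hc]
    congr 1 <;> simp <;> ring
  rw [h, smul_mem_farey]
  exact hz

lemma proj_eq_iff {n : ℕ} {z w : ℍ} :
    proj n z = proj n w ↔ ∃ A ∈ CongruenceSubgroup.Gamma0 n, z = A • w := by
  constructor
  · intro h
    obtain ⟨⟨A, hA⟩, h⟩ := Quotient.exact h
    exact ⟨A, hA, h.symm⟩
  · rintro ⟨A, hA, rfl⟩
    exact Quotient.sound ⟨⟨A, hA⟩, rfl⟩

lemma preimage_quotientTriangulation {n d : ℕ} (hd : 0 < d) (hdn : d ∣ n) :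
    proj n ⁻¹' quotientTriangulation n d = scaledFarey d := by
  ext z
  constructor
  · rintro ⟨w, hw, h⟩
    obtain ⟨A, hA, rfl⟩ := proj_eq_iff.mp h.symm
    exact smul_mem_scaledFarey hd hdn hA hw
  · exact fun hz => ⟨z, hz, rfl⟩

/-- Every point of an edge can be moved into the polygon by `Γ₀(n)`, and it stays on an edge. -/
lemma FareySymbol.IsTile.tileTriangulation_eq {σ : FareySymbol} {n d : ℕ} (h : σ.IsTile n)
    (hd : 0 < d) (hdn : d ∣ n) : σ.tileTriangulation n d = quotientTriangulation n d := by
  refine (Set.image_mono Set.inter_subset_right).antisymm ?_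
  rintro _ ⟨z, hz, rfl⟩
  obtain ⟨A, hA, hAz⟩ := h.covers z
  exact ⟨A • z, ⟨hAz, smul_mem_scaledFarey hd hdn hA hz⟩, proj_eq_iff.mpr ⟨A, hA, rfl⟩⟩

/-! ### Lifts of geodesics -/

/-- Fixing the point at height `y` forces `b = -c y²` and `a = d`; two different heights force `c =
0`. -/
lemma smul_eq_self_of_axisPoint {g : SL(2, ℝ)} {u v : ℝ} (huv : u ≠ v)
    (hu : g • axisPoint u = axisPoint u) (hv : g • axisPoint v = axisPoint v) (z : ℍ) :
    g • z = z := by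
  have hdet := det_eq g
  have key (t : ℝ) (ht : g • axisPoint t = axisPoint t) :
      g 0 1 = -(g 1 0 * Real.exp (2 * t)) ∧ g 1 1 = g 0 0 := by
    obtain ⟨h1, h2⟩ := smul_re_im_aux g (axisPoint t)
    rw [ht, axisPoint_re] at h1 h2
    simp only [mul_zero, zero_mul, zero_add, zero_sub] at h1 h2
    have := (axisPoint t).im_pos
    refine ⟨by rw [← axisPoint_im_sq]; linear_combination -h1, ?_⟩
    exact mul_left_cancel₀ this.ne' (by linear_combination h2)
  obtain ⟨h1, h2⟩ := key u hu
  have h3 := (key v hv).1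
  have hc : g 1 0 = 0 := by
    have h4 : g 1 0 * (Real.exp (2 * u) - Real.exp (2 * v)) = 0 := by linear_combination h1 - h3
    refine (mul_eq_zero.mp h4).resolve_right fun h5 => huv ?_
    have := Real.exp_injective (sub_eq_zero.mp h5)
    linarith
  have hb : g 0 1 = 0 := by rw [h1, hc]; ring
  obtain ⟨h4, h5⟩ := smul_eq_of_diag hb hc z
  have ha : g 0 0 ^ 2 = 1 := by rw [h2, hb] at hdet; linarith
  rw [ha, one_mul] at h4 h5
  exact UpperHalfPlane.ext (Complex.ext h4 h5)

lemma geodesic_eq_of_eq {g g' : SL(2, ℝ)} {u v : ℝ} (huv : u ≠ v)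
    (hu : geodesic g u = geodesic g' u) (hv : geodesic g v = geodesic g' v) :
    geodesic g = geodesic g' := by
  have h (t : ℝ) (ht : geodesic g t = geodesic g' t) : (g'⁻¹ * g) • axisPoint t = axisPoint t := by
    rw [mul_smul, inv_smul_eq_iff]; exact ht
  ext t : 1
  have := smul_eq_self_of_axisPoint huv (h u hu) (h v hv) (axisPoint t)
  rwa [mul_smul, inv_smul_eq_iff] at this

instance countable_SL2Z : Countable SL(2, ℤ) :=
  Function.Injective.countable (f := fun A : SL(2, ℤ) => fun i j => A i j)
    fun _ _ h => Matrix.SpecialLinearGroup.ext _ _ fun i j => congrFun (congrFun h i) j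

/-- Two lifts of a geodesic path on `Γ₀(n)\ℍ` differ by an element of `Γ₀(n)`. -/
lemma exists_geodesic_eq_smul {n : ℕ} {g g' : SL(2, ℝ)} {J : Set ℝ} (hJ : ¬ J.Countable)
    (h : ∀ u ∈ J, proj n (geodesic g u) = proj n (geodesic g' u)) :
    ∃ A ∈ CongruenceSubgroup.Gamma0 n, geodesic g = geodesic ((A : SL(2, ℝ)) * g') := by
  simp only [proj_eq_iff] at h
  choose! A hA hAg using h
  -- Pigeonhole: uncountably many times, countably many group elements. One element therefore serves
  -- two times, and two points determine the parametrised geodesic.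
  have hinj : ¬ Set.InjOn A J := fun hi =>
    hJ (Set.MapsTo.countable_of_injOn (Set.mapsTo_univ A J) hi Set.countable_univ)
  simp only [Set.InjOn, not_forall] at hinj
  obtain ⟨u, hu, v, hv, huv, hne⟩ := hinj
  refine ⟨A u, hA u hu, geodesic_eq_of_eq hne ?_ ?_⟩
  · rw [geodesic_mul, hAg u hu, ← coe_int_smul]
  · rw [geodesic_mul, hAg v hv, huv, ← coe_int_smul]

lemma preimage_scaledFarey {n d : ℕ} (hd : 0 < d) (hdn : d ∣ n) {A : SL(2, ℤ)}
    (hA : A ∈ CongruenceSubgroup.Gamma0 n) :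
    {z : ℍ | (A : SL(2, ℝ)) • z ∈ scaledFarey d} = scaledFarey d := by
  ext z
  rw [Set.mem_ofPred_eq, coe_int_smul]
  refine ⟨fun h => ?_, smul_mem_scaledFarey hd hdn hA⟩
  simpa using smul_mem_scaledFarey hd hdn (inv_mem hA) h

lemma orbCuts_iff {n d : ℕ} (hd : 0 < d) (hdn : d ∣ n) {ζ : ℝ → Orbifold n} {g : SL(2, ℝ)}
    {l : Letter} {s t : ℝ} (hζ : ∀ u, s ≤ u → ζ u = proj n (geodesic g u)) :
    OrbCuts n (quotientTriangulation n d) ζ l s t ↔ Cuts (scaledFarey d) (geodesic g) l s t := by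
  rw [OrbCuts, preimage_quotientTriangulation hd hdn]
  constructor
  · rintro ⟨g', h1, h2⟩
    obtain ⟨A, hA, h⟩ := exists_geodesic_eq_smul
      (Cardinal.Real.Icc_countable_iff.not.mpr h2.1.not_ge)
      fun u hu => (h1 u hu).trans (hζ u hu.1)
    rwa [h, geodesic_mul, ← cuts_preimage, preimage_scaledFarey hd hdn hA] at h2
  · exact fun h => ⟨g, fun u hu => (hζ u hu.1).symm, h⟩

lemma orbEndsAtVertex_iff {n d : ℕ} (hd : 0 < d) (hdn : d ∣ n) {ζ : ℝ → Orbifold n}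
    {g : SL(2, ℝ)} {s : ℝ} (hζ : ∀ u, s ≤ u → ζ u = proj n (geodesic g u)) :
    OrbEndsAtVertex n (quotientTriangulation n d) ζ s ↔
      EndsAtVertex (scaledFarey d) (geodesic g) s := by
  rw [OrbEndsAtVertex, preimage_quotientTriangulation hd hdn]
  constructor
  · rintro ⟨g', h1, h2⟩
    have hs : ¬ (Set.Ici s).Countable := by
      rw [← Cardinal.le_aleph0_iff_set_countable, Cardinal.mk_Ici_real, not_le]
      exact Cardinal.aleph0_lt_continuum
    obtain ⟨A, hA, h⟩ := exists_geodesic_eq_smul hs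
      fun u hu => (h1 u hu).trans (hζ u hu)
    rwa [h, geodesic_mul, ← endsAtVertex_preimage, preimage_scaledFarey hd hdn hA] at h2
  · exact fun h => ⟨g, fun u hu => (hζ u hu).symm, h⟩

/-- All entry times of a word are nonnegative, so it is enough to compare cuts and ends there; the
ray is a geodesic only for such times. -/
lemma IsCuttingWord.mono {cuts cuts' : Letter → ℝ → ℝ → Prop} {ends ends' : ℝ → Prop}
    {w : Stream'.Seq Letter} (hcuts : ∀ l s t, 0 ≤ s → cuts l s t → cuts' l s t)
    (hlt : ∀ l s t, cuts l s t → s < t) (hends : ∀ s, 0 ≤ s → ends s → ends' s)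
    (h : IsCuttingWord cuts ends w) : IsCuttingWord cuts' ends' w := by
  obtain ⟨t, ht0, hw0, hw⟩ := h
  have hpos (k : ℕ) (hk : w.get? k ≠ none) : 0 ≤ t k := by
    induction k with
    | zero => exact ht0.ge
    | succ k ih =>
      have hk' := get?_ne_none_of_le k.le_succ hk
      obtain ⟨l, hl⟩ := Option.ne_none_iff_exists'.mp hk'
      exact (ih hk').trans (hlt _ _ _ ((hw k l hl).resolve_right fun h => hk h.2).1).le
  refine ⟨t, ht0, hw0, fun k l hl => ?_⟩
  have h0 := hpos k (by simp [hl])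
  exact (hw k l hl).imp (fun h => ⟨hcuts _ _ _ h0 h.1, h.2⟩) fun h => ⟨hends _ h0 h.1, h.2⟩

lemma cuttingSequence_congr {X : Set ℍ} {γ γ' : ℝ → ℍ} (h : ∀ u, 0 ≤ u → γ u = γ' u) :
    cuttingSequence X γ = cuttingSequence X γ' := by
  ext w
  constructor <;>
  refine IsCuttingWord.mono (fun l s t hs => Cuts.congr fun u hu => ?_) (fun _ _ _ h => h.1)
    (fun s hs => EndsAtVertex.congr fun u hu => ?_)
  · exact h u (hs.trans hu)
  · exact h u (hs.trans hu)
  · exact (h u (hs.trans hu)).symm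
  · exact (h u (hs.trans hu)).symm

lemma OrbCuts.lt {n : ℕ} {T : Set (Orbifold n)} {ζ : ℝ → Orbifold n} {l : Letter} {s t : ℝ}
    (h : OrbCuts n T ζ l s t) : s < t := by
  obtain ⟨_, -, h⟩ := h
  exact h.1

lemma orbCuttingSequence_eq {n d : ℕ} (hd : 0 < d) (hdn : d ∣ n) {ζ : ℝ → Orbifold n}
    {g : SL(2, ℝ)} (hζ : ∀ u, 0 ≤ u → ζ u = proj n (geodesic g u)) :
    orbCuttingSequence n (quotientTriangulation n d) ζ =
      cuttingSequence (scaledFarey d) (geodesic g) := by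
  ext w
  constructor
  · exact IsCuttingWord.mono
      (fun l s t hs => (orbCuts_iff hd hdn fun u hu => hζ u (hs.trans hu)).mp)
      (fun _ _ _ h => h.lt)
      (fun s hs => (orbEndsAtVertex_iff hd hdn fun u hu => hζ u (hs.trans hu)).mp)
  · exact IsCuttingWord.mono
      (fun l s t hs => (orbCuts_iff hd hdn fun u hu => hζ u (hs.trans hu)).mpr)
      (fun _ _ _ h => h.1)
      (fun s hs => (orbEndsAtVertex_iff hd hdn fun u hu => hζ u (hs.trans hu)).mpr)

end CuttingSeq

end

theorem theorem3p2 (n : ℕ) (hn : 0 < n) (α : ℝ) (hα : 0 < α)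
    (γ : ℝ → UpperHalfPlane) (hγ : CuttingSeq.IsGeodesicRay γ) (hstart : γ 0 ∈ CuttingSeq.axis)
    (hend : Filter.Tendsto (fun t => (γ t : ℂ)) Filter.atTop (nhds (α : ℂ))) :
    ∃ ζ : ℝ → CuttingSeq.Orbifold n, (∀ t, ζ t = CuttingSeq.proj n (γ t)) ∧
      ∀ d : ℕ, d ∣ n →
        (∀ σ : CuttingSeq.FareySymbol, σ.IsTile n →
          σ.tileTriangulation n d = CuttingSeq.quotientTriangulation n d) ∧
        CuttingSeq.cuttingSequence (CuttingSeq.scaledFarey d) γ =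
          CuttingSeq.orbCuttingSequence n (CuttingSeq.quotientTriangulation n d) ζ ∧
        ∀ w : Stream'.Seq CuttingSeq.Letter,
          w ∈ CuttingSeq.orbCuttingSequence n (CuttingSeq.quotientTriangulation n d) ζ ↔
            ∃ a : CuttingSeq.IndexSeq, a.IsWord w ∧ a.IsExpansionOf (d * α) := by
  obtain ⟨g, hg⟩ := hγ
  refine ⟨fun t => CuttingSeq.proj n (γ t), fun _ => rfl, fun d hdn => ?_⟩
  have hd : 0 < d := Nat.pos_of_dvd_of_pos hdn hn
  have horb := CuttingSeq.orbCuttingSequence_eq (ζ := fun t => CuttingSeq.proj n (γ t)) hd hdn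
    (g := g) fun u hu => by rw [hg u hu]
  have hend' : Filter.Tendsto (fun t => (CuttingSeq.geodesic g t : ℂ)) Filter.atTop
      (nhds (α : ℂ)) := by
    refine hend.congr' ?_
    filter_upwards [Filter.eventually_ge_atTop 0] with t ht
    rw [hg t ht]
  have henters := CuttingSeq.enters_scaling_mul hd hα (hg 0 le_rfl ▸ hstart) hend'
  refine ⟨fun σ hσ => hσ.tileTriangulation_eq hd hdn, ?_, fun w => ?_⟩
  · rw [horb]
    exact CuttingSeq.cuttingSequence_congr hg
  · rw [horb, CuttingSeq.cuttingSequence_scaledFarey hd, henters.mem_cuttingSequence_iff,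
      CuttingSeq.isFareyWord_iff henters.1]
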